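/- **Consistency of $\hat V_{v'}$.** Consider $d$ time series, series $j$ having a $p^{(j)}$-dimensional state, and put $p=p^{(1)}+\dots+p^{(d)}$. Let $Z=\mathrm{Diag}(Z^{(1)},\dots,Z^{(d)})$ ($d\times p$, each $Z^{(j)}$ a $1\times p^{(j)}$ row) and $T=\mathrm{Diag}(T^{(1)},\dots,T^{(d)})$ ($p\times p$, each $T^{(j)}$ of size $p^{(j)}\times p^{(j)}$) be time-independent, and number times $t=0,1,2,\dots$. The true model is the linear Gaussian state-space model $$y_t=Z\alpha_t+\varepsilon_t,\qquad \alpha_{t+1}=T\alpha_t+\eta_t ,$$ where $\alpha_0\sim N(a_0,P_0)$, $\varepsilon_t\sim N(0,\Sigma_\varepsilon)$, $\eta_t\sim N(0,\Sigma_\eta)$ $(t\ge 0)$ are jointly Gaussian and mutually uncorrelated. Let $\Sigma_\varepsilon'$ be the diagonal part of $\Sigma_\varepsilon$ and $\Sigma_\eta'$ the block diagonal part of $\Sigma_\eta$ (blocks of sizes $p^{(j)}$). Let $P_0'=\mathrm{Diag}(P_0'^{(1)},\dots,P_0'^{(d)})$ with positive semidefinite $P_0'^{(j)}$, and $a_0'\in\mathbb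 R^p$, be arbitrary deterministic initial values. The Kalman filter that disregards the correlation between the series is $$v_t'=y_t-Za_t',\quad F_t'=ZP_t'Z^T+\Sigma_\varepsilon',\quad K_t'=P_t'Z^TF_t'^{-1},\quad L_t'=I_p-K_t'Z,$$ $$a_{t+1}'=Ta_t'+TK_t'v_t',\qquad P_{t+1}'=TP_t'L_t'^TT^T+\Sigma_\eta'.$$ Assume: 1. $\Sigma_\varepsilon$ and $\Sigma_\varepsilon'$ are positive definite. 2. The stacked matrix $(Z^T,(ZT)^T,\dots,(ZT^{p-1})^T)^T$ has rank $p$. 3. $\Sigma_\eta=RQR^T$ with $R$ a $p\times r$ matrix and $Q$ an $r\times r$ positive definite matrix such that $\mathrm{rank}(R,TR,\dots,T^{p-1}R)=p$; likewise $\Sigma_\eta'=R'Q'R'^T$ with $Q'$ positive definite and $\mathrm{rank}(R',TR',\dots,T^{p-1}R')=p$. 4. There is $M>0$ such that $\|(TL'_{t-k})(TL'_{t-k-1})\cdots(TL'_{t-l})\|_F\le M$ for all integers $0\le k\le l\le t$, where $\|\cdot\|_F$ is the Frobenius norm. Then the components of every $v'_t$ are square integrable, and the covariance matrices $V(v_t')$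 converge, as $t\to\infty$, to a matrix $V_{v'}$. Moreover, for every fixed $n_0\ge 0$, the sample covariance $$\hat V_{v'}=\frac1{n-n_0+1}\sum_{t=n_0}^n v_t'v_t'^T$$ is a consistent estimator of $V_{v'}$ as $n\to\infty$: for all $i,j$, the entry $\hat V_{v'}(i,j)$ is square integrable, $$E\bigl(\hat V_{v'}(i,j)\bigr)\to V_{v'}(i,j),\qquad V\bigl(\hat V_{v'}(i,j)\bigr)=O(1/n),\qquad \hat V_{v'}(i,j)\xrightarrow{\,p\,}V_{v'}(i,j).$$ -/

import Mathlib

open MeasureTheory ProbabilityTheory Filter Topology Asymptotics Matrix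

noncomputable section

namespace SUTSE

/-- Index set of the stacked state vector: pairs `⟨j, k⟩` with `k < p j`; its cardinality is
`p 0 + ⋯ + p (d - 1)`. -/
abbrev StateIdx {d : ℕ} (p : Fin d → ℕ) : Type := Σ j : Fin d, Fin (p j)

/-- Parameters of a SUTSE model with time-independent design and transition matrices.
Times are numbered `0, 1, 2, …`, so that index `0` is the initial time. -/
structure Model (d : ℕ) (p : Fin d → ℕ) where
  /-- the `1 × p j` design matrix of series `j`, as a row vector -/
  zrow : ∀ j, Fin (p j) → ℝ
  /-- the `p j × p j` transition matrix of series `j` -/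
  tblock : ∀ j, Matrix (Fin (p j)) (Fin (p j)) ℝ
  /-- covariance matrix of the observation noise -/
  covEps : Matrix (Fin d) (Fin d) ℝ
  /-- covariance matrix of the state noise -/
  covEta : Matrix (StateIdx p) (StateIdx p) ℝ
  /-- mean of the initial state -/
  mean0 : StateIdx p → ℝ
  /-- covariance matrix of the initial state -/
  cov0 : Matrix (StateIdx p) (StateIdx p) ℝ

/-- Frobenius norm. -/
def frobNorm {m n : Type*} [Fintype m] [Fintype n] (A : Matrix m n ℝ) : ℝ :=
  Real.sqrt (∑ i, ∑ j, A i j ^ 2)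

/-- `Var(X)`, the covariance matrix of a random vector `X`. -/
def covMatrix {Ω ι : Type*} [MeasurableSpace Ω] (μ : Measure Ω) (X : Ω → ι → ℝ) :
    Matrix ι ι ℝ :=
  Matrix.of fun i j => cov[fun ω => X ω i, fun ω => X ω j; μ]

/-- The stacked matrix `(Zᵀ, (ZT)ᵀ, …, (ZT^(q-1))ᵀ)ᵀ`. -/
def obsMatrix {m s : Type*} [Fintype s] [DecidableEq s] (Z : Matrix m s ℝ) (T : Matrix s s ℝ)
    (q : ℕ) : Matrix (Fin q × m) s ℝ :=
  Matrix.of fun ki j => (Z * T ^ (ki.1 : ℕ)) ki.2 j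

/-- The matrix `(R, TR, …, T^(q-1) R)`. -/
def ctrlMatrix {s r : Type*} [Fintype s] [DecidableEq s] (T : Matrix s s ℝ) (R : Matrix s r ℝ)
    (q : ℕ) : Matrix s (Fin q × r) ℝ :=
  Matrix.of fun i kj => (T ^ (kj.1 : ℕ) * R) i kj.2

/-- `S = R Q Rᵀ` for some `R` and some positive definite `Q` such that
`(R, TR, …, T^(q-1) R)` has rank `q`, where `q` is the dimension of the state. -/
def Controllable {s : Type*} [Fintype s] [DecidableEq s] (T S : Matrix s s ℝ) : Prop :=
  ∃ (r : ℕ) (R : Matrix s (Fin r) ℝ) (Q : Matrix (Fin r) (Fin r) ℝ),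
    Q.PosDef ∧ S = R * Q * Rᵀ ∧ (ctrlMatrix T R (Fintype.card s)).rank = Fintype.card s

section Kalman

variable {m s : Type*} [Fintype m] [DecidableEq m] [Fintype s] [DecidableEq s]

/-- `F = Z P Zᵀ + Σ_ε`. -/
def kalmanF (Z : Matrix m s ℝ) (Se : Matrix m m ℝ) (P : Matrix s s ℝ) : Matrix m m ℝ :=
  Z * P * Zᵀ + Se

/-- `K = P Zᵀ F⁻¹`. -/
def kalmanK (Z : Matrix m s ℝ) (Se : Matrix m m ℝ) (P : Matrix s s ℝ) : Matrix s m ℝ :=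
  P * Zᵀ * (kalmanF Z Se P)⁻¹

/-- `L = I - K Z`. -/
def kalmanL (Z : Matrix m s ℝ) (Se : Matrix m m ℝ) (P : Matrix s s ℝ) : Matrix s s ℝ :=
  1 - kalmanK Z Se P * Z

/-- `P_{t+1} = T P_t L_tᵀ Tᵀ + Σ_η`, started at `P0`. -/
def kalmanP (Z : Matrix m s ℝ) (T : Matrix s s ℝ) (Se : Matrix m m ℝ) (Sn P0 : Matrix s s ℝ) :
    ℕ → Matrix s s ℝ
  | 0 => P0
  | t + 1 =>
    T * kalmanP Z T Se Sn P0 t * (kalmanL Z Se (kalmanP Z T Se Sn P0 t))ᵀ * Tᵀ + Sn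

/-- `a_{t+1} = T a_t + T K_t (y_t - Z a_t)`, started at `a0`, for the data `y`. -/
def kalmanA (Z : Matrix m s ℝ) (T : Matrix s s ℝ) (Se : Matrix m m ℝ) (Sn P0 : Matrix s s ℝ)
    (a0 : s → ℝ) (y : ℕ → m → ℝ) : ℕ → s → ℝ
  | 0 => a0
  | t + 1 =>
    T *ᵥ kalmanA Z T Se Sn P0 a0 y t +
      (T * kalmanK Z Se (kalmanP Z T Se Sn P0 t)) *ᵥ
        (y t - Z *ᵥ kalmanA Z T Se Sn P0 a0 y t)

end Kalman

namespace Model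

variable {d : ℕ} {p : Fin d → ℕ} (M : Model d p)

/-- `Z = Diag(Z^(1), …, Z^(d))`. -/
def Z : Matrix (Fin d) (StateIdx p) ℝ :=
  Matrix.of fun i s => if i = s.1 then M.zrow s.1 s.2 else 0

/-- `T = Diag(T^(1), …, T^(d))`. -/
def T : Matrix (StateIdx p) (StateIdx p) ℝ := Matrix.blockDiagonal' M.tblock

/-- `Σ_ε'`, the diagonal part of `Σ_ε`. -/
def covEps' : Matrix (Fin d) (Fin d) ℝ := Matrix.diagonal fun j => M.covEps j j

/-- `Σ_η'`, the block diagonal part of `Σ_η`. -/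
def covEta' : Matrix (StateIdx p) (StateIdx p) ℝ :=
  Matrix.blockDiagonal' (Matrix.blockDiag' M.covEta)

/-- The state: `α_{t+1} = T α_t + η_t`, started at the random vector `α0`. -/
def state {Ω : Type*} (α0 : Ω → StateIdx p → ℝ) (η : ℕ → Ω → StateIdx p → ℝ) :
    ℕ → Ω → StateIdx p → ℝ
  | 0 => α0
  | t + 1 => fun ω => M.T *ᵥ state α0 η t ω + η t ω

/-- The observations: `y_t = Z α_t + ε_t`. -/
def obs {Ω : Type*} (α0 : Ω → StateIdx p → ℝ) (ε : ℕ → Ω → Fin d → ℝ)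
    (η : ℕ → Ω → StateIdx p → ℝ) (t : ℕ) (ω : Ω) : Fin d → ℝ :=
  M.Z *ᵥ M.state α0 η t ω + ε t ω

/-- The random inputs of the model: jointly Gaussian, with `α0 ~ N(mean0, cov0)`,
`ε_t ~ N(0, Σ_ε)`, `η_t ~ N(0, Σ_η)`, all mutually uncorrelated. -/
structure IsInput {Ω : Type*} [MeasurableSpace Ω] (μ : Measure Ω) (α0 : Ω → StateIdx p → ℝ)
    (ε : ℕ → Ω → Fin d → ℝ) (η : ℕ → Ω → StateIdx p → ℝ) : Prop where
  gaussian : IsGaussianProcess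
    (Sum.elim (fun k ω => α0 ω k)
      (Sum.elim (fun (ti : ℕ × Fin d) ω => ε ti.1 ω ti.2)
        (fun (tk : ℕ × StateIdx p) ω => η tk.1 ω tk.2)) :
      StateIdx p ⊕ (ℕ × Fin d) ⊕ (ℕ × StateIdx p) → Ω → ℝ) μ
  mean_init : ∀ k, ∫ ω, α0 ω k ∂μ = M.mean0 k
  mean_eps : ∀ t i, ∫ ω, ε t ω i ∂μ = 0
  mean_eta : ∀ t k, ∫ ω, η t ω k ∂μ = 0
  cov_init : covMatrix μ α0 = M.cov0
  cov_eps : ∀ t, covMatrix μ (ε t) = M.covEps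
  cov_eta : ∀ t, covMatrix μ (η t) = M.covEta
  uncorr_eps : ∀ t u, t ≠ u → ∀ i j, cov[fun ω => ε t ω i, fun ω => ε u ω j; μ] = 0
  uncorr_eta : ∀ t u, t ≠ u → ∀ k l, cov[fun ω => η t ω k, fun ω => η u ω l; μ] = 0
  uncorr_eps_eta : ∀ t u i k, cov[fun ω => ε t ω i, fun ω => η u ω k; μ] = 0
  uncorr_init_eps : ∀ t k i, cov[fun ω => α0 ω k, fun ω => ε t ω i; μ] = 0
  uncorr_init_eta : ∀ t k l, cov[fun ω => α0 ω k, fun ω => η t ω l; μ] = 0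

/-- `P'_t`: the Kalman filter that disregards the correlation between the `d` series, started
from `Diag(P0' 1, …, P0' d)`. -/
def P' (P0' : ∀ j, Matrix (Fin (p j)) (Fin (p j)) ℝ) (t : ℕ) :
    Matrix (StateIdx p) (StateIdx p) ℝ :=
  kalmanP M.Z M.T M.covEps' M.covEta' (Matrix.blockDiagonal' P0') t

/-- `L'_t`. -/
def L' (P0' : ∀ j, Matrix (Fin (p j)) (Fin (p j)) ℝ) (t : ℕ) :
    Matrix (StateIdx p) (StateIdx p) ℝ :=
  kalmanL M.Z M.covEps' (M.P' P0' t)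

/-- `v'_t = y_t - Z a'_t`, the one-step-ahead forecast error of the Kalman filter that disregards
the correlation between the series, applied to the observations of the model. -/
def v' {Ω : Type*} (a0' : StateIdx p → ℝ) (P0' : ∀ j, Matrix (Fin (p j)) (Fin (p j)) ℝ)
    (α0 : Ω → StateIdx p → ℝ) (ε : ℕ → Ω → Fin d → ℝ) (η : ℕ → Ω → StateIdx p → ℝ)
    (t : ℕ) (ω : Ω) : Fin d → ℝ :=
  M.obs α0 ε η t ω -
    M.Z *ᵥ kalmanA M.Z M.T M.covEps' M.covEta' (Matrix.blockDiagonal' P0') a0'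
      (fun u => M.obs α0 ε η u ω) t

/-- The four standing assumptions. In the last one the product is
`(T L'_{t-k}) (T L'_{t-k-1}) ⋯ (T L'_{t-l})`. -/
structure Assumptions (P0' : ∀ j, Matrix (Fin (p j)) (Fin (p j)) ℝ) : Prop where
  posDef : M.covEps.PosDef
  posDef' : M.covEps'.PosDef
  observable : (obsMatrix M.Z M.T (Fintype.card (StateIdx p))).rank = Fintype.card (StateIdx p)
  controllable : Controllable M.T M.covEta
  controllable' : Controllable M.T M.covEta'
  bounded : ∃ C : ℝ, 0 < C ∧ ∀ k l t : ℕ, k ≤ l → l ≤ t →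
    frobNorm ((List.range' k (l + 1 - k)).map fun i => M.T * M.L' P0' (t - i)).prod ≤ C

end Model

/-- `(n - n₀ + 1)⁻¹ ∑_{t = n₀}^{n} v_t v_tᵀ`. -/
def sampleCov {Ω ι : Type*} (v : ℕ → Ω → ι → ℝ) (n₀ n : ℕ) (ω : Ω) : Matrix ι ι ℝ :=
  ((n : ℝ) - n₀ + 1)⁻¹ • ∑ t ∈ Finset.Icc n₀ n, Matrix.vecMulVec (v t ω) (v t ω)

end SUTSE

end

/-!
The proof follows the prediction error `x_t = α_t - a'_t` of the misspecified filter. It satisfies a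
linear recursion `x_{t+1} = A_t x_t + η_t - T K'_t ε_t` with `A_t = T L'_t`, and
`v'_t = Z x_t + ε_t` (`Model.predError_succ`, `Model.v'_eq`). The covariances `Σ_ε` and `Σ_η` of the
true model enter only as covariances of the noise; the matrices `A_t` and `K'_t` are deterministic
and belong to the Riccati recursion of the pair `Σ_ε'`, `Σ_η'`.

*Riccati recursion.* Started at `0`, the recursion is increasing, and observability bounds it by the
error covariance of a dead-beat filter, so it converges to a fixed point
(`exists_tendsto_kalmanP_zero`). Controllability makes the closed-loop matrix of the fixed point
stable (`tendsto_pow_of_riccati_fixed`). Two Riccati sequences differ by `Φ₁ (P₁ - P₂) Φ₂ᵀ`, where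
`Φ₁` and `Φ₂` are the products of their closed-loop matrices (`kalmanP_sub_kalmanP`). For the given
initial value the products are bounded by assumption, and for the initial value `0` they tend to
`0`; hence `P'_t` has the same limit (`exists_kalman_limit`). It follows that `A_t` converges to a
stable matrix, and that products of `k` consecutive `A_t` decay geometrically in `k`, uniformly in
the starting time (`exists_norm_transition_le_geometric`).

*Second moments.* The covariance matrices of `x_t` solve a Lyapunov recursion with convergent
coefficients, so they converge (`exists_tendsto_of_lyapunov_recursion`). The autocovariances of
`v'_t` decay geometrically in the lag and the means tend to `0`
(`IsStateSpace.exists_stationary_limit`).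

*Sample covariance.* The mean of the sample covariance converges by Cesàro's theorem. For the
variance, the product `v_i v_j` is a quarter of the difference of the squares of `v_i + v_j` and
`v_i - v_j`. For jointly Gaussian `X`, `Y` one has
`Cov(X², Y²) = 2 Cov(X, Y)² + 4 E X E Y Cov(X, Y)` (`covariance_sq_sq_of_hasGaussianLaw`), so the
covariances of the squares decay geometrically as well and the variance of an average of `n` of them
is `O(1/n)`. Chebyshev's inequality, in the form that convergence in `L²` implies convergence in
measure, gives consistency (`sampleCov_consistent`).
-/

noncomputable section

namespace SUTSE

/-! ### The Riccati step of the Kalman filter -/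

section Riccati

lemma posSemidef_mul_mul_transpose {k s : Type*} [Fintype k] [Fintype s] {P : Matrix s s ℝ}
    (hP : P.PosSemidef) (B : Matrix k s ℝ) : (B * P * Bᵀ).PosSemidef := by
  simpa using hP.mul_mul_conjTranspose_same B

lemma transpose_eq_self_of_posSemidef {s : Type*} {P : Matrix s s ℝ} (hP : P.PosSemidef) :
    Pᵀ = P := by
  simpa [Matrix.IsHermitian] using hP.isHermitian

variable {k m s : Type*} [Fintype m] [DecidableEq m] [Fintype s] [DecidableEq s]

/-- One step `P ↦ T P Lᵀ Tᵀ + Σ_η` of the Riccati recursion of the Kalman filter, so that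
`kalmanP Z T Se Sn P₀ (t + 1) = riccati Z T Se Sn (kalmanP Z T Se Sn P₀ t)` by definition. -/
def riccati (Z : Matrix m s ℝ) (T : Matrix s s ℝ) (Se : Matrix m m ℝ) (Sn P : Matrix s s ℝ) :
    Matrix s s ℝ :=
  T * P * (kalmanL Z Se P)ᵀ * Tᵀ + Sn

variable {Z : Matrix m s ℝ} {T : Matrix s s ℝ} {Se : Matrix m m ℝ} {Sn P : Matrix s s ℝ}

omit [DecidableEq m] [DecidableEq s] in
lemma kalmanF_posDef (hSe : Se.PosDef) (hP : P.PosSemidef) : (kalmanF Z Se P).PosDef :=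
  Matrix.PosDef.posSemidef_add (posSemidef_mul_mul_transpose hP Z) hSe

omit [DecidableEq s] in
lemma kalmanK_mul_kalmanF (hSe : Se.PosDef) (hP : P.PosSemidef) :
    kalmanK Z Se P * kalmanF Z Se P = P * Zᵀ := by
  have h := (Matrix.isUnit_iff_isUnit_det _).1 (kalmanF_posDef (Z := Z) hSe hP).isUnit
  rw [kalmanK, Matrix.nonsing_inv_mul_cancel_right _ _ h]

omit [DecidableEq s] in
lemma kalmanF_mul_kalmanK_transpose (hSe : Se.PosDef) (hP : P.PosSemidef) :
    kalmanF Z Se P * (kalmanK Z Se P)ᵀ = Z * P := by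
  have h := congrArg Matrix.transpose (kalmanK_mul_kalmanF (Z := Z) hSe hP)
  rwa [Matrix.transpose_mul, Matrix.transpose_mul, Matrix.transpose_transpose,
    transpose_eq_self_of_posSemidef hP,
    transpose_eq_self_of_posSemidef (kalmanF_posDef (Z := Z) hSe hP).posSemidef] at h

/-- Completion of squares: among all matrices `U`, the quadratic form on the left is minimal for
`U = W T K`, where it equals `W * riccati P * Wᵀ`. Rectangular `W` are allowed. -/
lemma riccati_complete_square (hSe : Se.PosDef) (hP : P.PosSemidef)
    (W : Matrix k s ℝ) (U : Matrix k m ℝ) :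
    (W * T - U * Z) * P * (W * T - U * Z)ᵀ + U * Se * Uᵀ + W * Sn * Wᵀ =
      W * riccati Z T Se Sn P * Wᵀ +
        (U - W * T * kalmanK Z Se P) * kalmanF Z Se P * (U - W * T * kalmanK Z Se P)ᵀ := by
  have h1 := kalmanK_mul_kalmanF (Z := Z) hSe hP
  have h2 := kalmanF_mul_kalmanK_transpose (Z := Z) hSe hP
  have h3 : (U - W * T * kalmanK Z Se P) * kalmanF Z Se P * (U - W * T * kalmanK Z Se P)ᵀ =
      U * kalmanF Z Se P * Uᵀ - U * (kalmanF Z Se P * (kalmanK Z Se P)ᵀ) * Tᵀ * Wᵀ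
        - W * T * (kalmanK Z Se P * kalmanF Z Se P) * Uᵀ
        + W * T * (kalmanK Z Se P * kalmanF Z Se P) * (kalmanK Z Se P)ᵀ * Tᵀ * Wᵀ := by
    simp only [Matrix.sub_mul, Matrix.mul_sub, Matrix.transpose_sub, Matrix.transpose_mul,
      Matrix.mul_assoc]
    abel
  rw [h3, h1, h2, kalmanF, riccati, kalmanL]
  simp only [Matrix.sub_mul, Matrix.mul_sub, Matrix.transpose_sub, Matrix.transpose_mul,
      Matrix.mul_assoc, Matrix.mul_add, Matrix.add_mul, Matrix.transpose_one, Matrix.one_mul]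
  abel

/-- The Joseph form of the Riccati step, a sum of manifestly positive semidefinite terms. -/
lemma riccati_eq_joseph (hSe : Se.PosDef) (hP : P.PosSemidef) :
    riccati Z T Se Sn P = (T * kalmanL Z Se P) * P * (T * kalmanL Z Se P)ᵀ +
      ((T * kalmanK Z Se P) * Se * (T * kalmanK Z Se P)ᵀ + Sn) := by
  have h := riccati_complete_square (Z := Z) (T := T) (Sn := Sn) hSe hP (1 : Matrix s s ℝ)
    (T * kalmanK Z Se P)
  simp only [Matrix.one_mul, sub_self, Matrix.zero_mul, Matrix.transpose_one, Matrix.mul_one,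
    add_zero] at h
  rw [← h, kalmanL, Matrix.mul_sub, Matrix.mul_one, Matrix.mul_assoc T, add_assoc]

lemma riccati_posSemidef (hSe : Se.PosDef) (hSn : Sn.PosSemidef) (hP : P.PosSemidef) :
    (riccati Z T Se Sn P).PosSemidef := by
  rw [riccati_eq_joseph hSe hP]
  exact (posSemidef_mul_mul_transpose hP _).add
    ((posSemidef_mul_mul_transpose hSe.posSemidef _).add hSn)

/-- Optimality of the Kalman gain in the Loewner order: no choice of `U` gives a smaller error
covariance than the Riccati step. -/
lemma riccati_le [Fintype k] (hSe : Se.PosDef) (hP : P.PosSemidef) (W : Matrix k s ℝ)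
    (U : Matrix k m ℝ) :
    ((W * T - U * Z) * P * (W * T - U * Z)ᵀ + U * Se * Uᵀ + W * Sn * Wᵀ -
      W * riccati Z T Se Sn P * Wᵀ).PosSemidef := by
  rw [riccati_complete_square hSe hP, add_sub_cancel_left]
  exact posSemidef_mul_mul_transpose (kalmanF_posDef hSe hP).posSemidef _

/-- The Riccati step is monotone in the Loewner order. The gain of the larger matrix is suboptimal
for the smaller one. -/
lemma riccati_mono {P₁ P₂ : Matrix s s ℝ} (hSe : Se.PosDef) (h₁ : P₁.PosSemidef)
    (h₂ : P₂.PosSemidef) (h : (P₂ - P₁).PosSemidef) :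
    (riccati Z T Se Sn P₂ - riccati Z T Se Sn P₁).PosSemidef := by
  have h3 := riccati_le (Z := Z) (T := T) (Sn := Sn) hSe h₁ (1 : Matrix s s ℝ) (T * kalmanK Z Se P₂)
  have h4 := posSemidef_mul_mul_transpose h (T * kalmanL Z Se P₂)
  convert h4.add h3 using 1
  rw [riccati_eq_joseph hSe h₂, kalmanL]
  simp only [Matrix.mul_sub, Matrix.sub_mul, Matrix.one_mul, Matrix.mul_one,
    Matrix.mul_assoc, Matrix.transpose_one]
  abel

lemma kalmanL_mul_transpose_comm (hP : P.PosSemidef) (hSe : Se.PosDef) :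
    P * (kalmanL Z Se P)ᵀ = kalmanL Z Se P * P := by
  have h1 := kalmanK_mul_kalmanF (Z := Z) hSe hP
  have h2 := kalmanF_mul_kalmanK_transpose (Z := Z) hSe hP
  have : P * (Zᵀ * (kalmanK Z Se P)ᵀ) = kalmanK Z Se P * (Z * P) := by
    rw [← h2, ← Matrix.mul_assoc, ← h1, Matrix.mul_assoc]
  simp [kalmanL, Matrix.mul_sub, Matrix.sub_mul, Matrix.mul_assoc, this]

lemma kalmanL_mul_design (hP : P.PosSemidef) (hSe : Se.PosDef) :
    kalmanL Z Se P * (P * Zᵀ) = kalmanK Z Se P * Se := by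
  have h1 := kalmanK_mul_kalmanF (Z := Z) hSe hP
  have h2 : P * Zᵀ = kalmanK Z Se P * (Z * P * Zᵀ + Se) := h1.symm
  rw [kalmanL, Matrix.sub_mul, Matrix.one_mul, sub_eq_iff_eq_add]
  conv_lhs => rw [h2]
  rw [Matrix.mul_add, add_comm]
  simp only [Matrix.mul_assoc]

/-- The difference of two Riccati steps is linear in `P₁ - P₂`, multiplied on the two sides by
*different* closed-loop matrices. Stability of one factor and boundedness of the other thus suffice
to compare two filters with different initial values. -/
lemma riccati_sub_riccati {P₁ P₂ : Matrix s s ℝ} (hSe : Se.PosDef) (h₁ : P₁.PosSemidef)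
    (h₂ : P₂.PosSemidef) :
    riccati Z T Se Sn P₁ - riccati Z T Se Sn P₂ =
      (T * kalmanL Z Se P₁) * (P₁ - P₂) * (T * kalmanL Z Se P₂)ᵀ := by
  have a1 := kalmanL_mul_design (Z := Z) h₁ hSe
  have a2 := congrArg Matrix.transpose (kalmanL_mul_design (Z := Z) h₂ hSe)
  simp only [Matrix.transpose_mul, Matrix.transpose_transpose,
    transpose_eq_self_of_posSemidef h₂, transpose_eq_self_of_posSemidef hSe.posSemidef] at a2
  have b1 : kalmanL Z Se P₁ * P₁ * (kalmanL Z Se P₂)ᵀ =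
      kalmanL Z Se P₁ * P₁ - kalmanK Z Se P₁ * Se * (kalmanK Z Se P₂)ᵀ := by
    rw [← a1, kalmanL, kalmanL]
    simp [Matrix.mul_sub, Matrix.mul_assoc]
  have b2 : kalmanL Z Se P₁ * P₂ * (kalmanL Z Se P₂)ᵀ =
      P₂ * (kalmanL Z Se P₂)ᵀ - kalmanK Z Se P₁ * Se * (kalmanK Z Se P₂)ᵀ := by
    rw [Matrix.mul_assoc (kalmanK Z Se P₁), ← a2]
    rw [show kalmanL Z Se P₁ = 1 - kalmanK Z Se P₁ * Z from rfl]
    simp only [Matrix.sub_mul, Matrix.one_mul, Matrix.mul_assoc]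
  have : (T * kalmanL Z Se P₁) * (P₁ - P₂) * (T * kalmanL Z Se P₂)ᵀ =
      T * (kalmanL Z Se P₁ * P₁ * (kalmanL Z Se P₂)ᵀ -
        kalmanL Z Se P₁ * P₂ * (kalmanL Z Se P₂)ᵀ) * Tᵀ := by
    simp only [Matrix.sub_mul, Matrix.mul_sub, Matrix.transpose_mul, Matrix.mul_assoc]
  rw [this, b1, b2, ← kalmanL_mul_transpose_comm h₁ hSe, riccati, riccati]
  simp only [Matrix.sub_mul, Matrix.mul_sub, Matrix.mul_assoc]
  abel

end Riccati

/-! ### Products of a convergent sequence of ring elements -/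

section Transition

variable {R : Type*}

/-- The transition product `A (u + k - 1) * ⋯ * A (u + 1) * A u` of `k` factors. -/
def transition [Monoid R] (A : ℕ → R) (u : ℕ) : ℕ → R
  | 0 => 1
  | k + 1 => A (u + k) * transition A u k

lemma transition_add [Monoid R] (A : ℕ → R) (u k l : ℕ) :
    transition A u (k + l) = transition A (u + k) l * transition A u k := by
  induction l with
  | zero => simp [transition]
  | succ l ih => rw [← add_assoc, transition, transition, ih, mul_assoc, add_assoc]

lemma transition_eq_list_prod [Monoid R] (A : ℕ → R) (u k : ℕ) :
    transition A u (k + 1) = ((List.range' 0 (k + 1)).map fun i => A (u + k - i)).prod := by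
  induction k with
  | zero => simp [transition]
  | succ k ih =>
    have h : List.range' 0 (k + 1 + 1) = 0 :: (List.range' 0 (k + 1)).map (1 + ·) := by
      rw [List.range'_succ, List.map_add_range']
    rw [transition, ih, h, List.map_cons, List.prod_cons, Nat.sub_zero, List.map_map]
    congr 2
    refine List.map_congr_left fun i _ => ?_
    simp only [Function.comp_apply]
    congr 1
    omega

lemma tendsto_transition [Monoid R] [TopologicalSpace R] [ContinuousMul R] {A : ℕ → R} {A₀ : R}
    (hA : Tendsto A atTop (𝓝 A₀)) (k : ℕ) :
    Tendsto (fun u => transition A u k) atTop (𝓝 (A₀ ^ k)) := by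
  induction k with
  | zero => simpa [transition] using tendsto_const_nhds
  | succ k ih =>
    rw [pow_succ']
    exact (hA.comp (tendsto_add_atTop_nat k)).mul ih

lemma norm_transition_le [NormedRing R] {A : ℕ → R} {b : ℝ} (hA : ∀ t, ‖A t‖ ≤ b) (u k : ℕ) :
    ‖transition A u k‖ ≤ ‖(1 : R)‖ * b ^ k := by
  induction k with
  | zero => simp [transition]
  | succ k ih =>
    calc ‖A (u + k) * transition A u k‖ ≤ ‖A (u + k)‖ * ‖transition A u k‖ := norm_mul_le _ _
      _ ≤ b * (‖(1 : R)‖ * b ^ k) :=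
        mul_le_mul (hA _) ih (norm_nonneg _) ((norm_nonneg _).trans (hA 0))
      _ = ‖(1 : R)‖ * b ^ (k + 1) := by ring

/-- If `A t → A₀` and `A₀ ^ k → 0`, then the products of `k` consecutive factors `A t` decay
geometrically in `k`, uniformly in the starting time. -/
lemma exists_norm_transition_le_geometric [NormedRing R] {A : ℕ → R} {A₀ : R}
    (hA : Tendsto A atTop (𝓝 A₀)) (hpow : Tendsto (fun k => A₀ ^ k) atTop (𝓝 0)) :
    ∃ C ρ : ℝ, 0 ≤ C ∧ 0 < ρ ∧ ρ < 1 ∧ ∀ u k, ‖transition A u k‖ ≤ C * ρ ^ k := by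
  obtain ⟨b₀, hb₀⟩ := hA.norm.bddAbove_range
  obtain ⟨b, hb1, hb⟩ : ∃ b : ℝ, 1 ≤ b ∧ ∀ t, ‖A t‖ ≤ b :=
    ⟨max b₀ 1, le_max_right _ _, fun t => (hb₀ ⟨t, rfl⟩).trans (le_max_left _ _)⟩
  have hcrude := norm_transition_le hb
  set e : ℝ := ‖(1 : R)‖ with he
  have he0 : 0 ≤ e := norm_nonneg _
  have hpow' : Tendsto (fun k => ‖A₀ ^ k‖) atTop (𝓝 0) := by simpa using hpow.norm
  obtain ⟨N, hN, hN1⟩ := ((hpow'.eventually (gt_mem_nhds (show (0 : ℝ) < 1 / 2 by norm_num))).and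
    (eventually_ge_atTop 1)).exists
  obtain ⟨t₀, ht₀⟩ := eventually_atTop.1
    ((tendsto_transition hA N).norm.eventually (gt_mem_nhds hN))
  -- `ρ` is chosen such that `ρ ^ N = 1 / 2`.
  set ρ : ℝ := (1 / 2 : ℝ) ^ ((N : ℝ)⁻¹) with hρ
  have hρ0 : 0 < ρ := by positivity
  have hρN : ρ ^ N = 1 / 2 := Real.rpow_inv_natCast_pow (by norm_num) (by omega)
  have hρ1 : ρ < 1 := Real.rpow_lt_one (by norm_num) (by norm_num) (by positivity)
  -- Blocks of `N` factors that start after time `t₀` have norm at most `1 / 2`.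
  have hlate : ∀ k, ∀ u, t₀ ≤ u → ‖transition A u k‖ ≤ 2 * e * b ^ N * ρ ^ k := by
    intro k
    induction k using Nat.strong_induction_on with
    | _ k ih =>
      intro u hu
      rcases lt_or_ge k N with hk | hk
      · have h1 : b ^ k ≤ b ^ N := pow_le_pow_right₀ hb1 hk.le
        have h2 : 1 / 2 ≤ ρ ^ k := hρN ▸ pow_le_pow_of_le_one hρ0.le hρ1.le hk.le
        calc ‖transition A u k‖ ≤ e * b ^ k := hcrude u k
          _ ≤ e * b ^ N := by gcongr
          _ = 2 * e * b ^ N * (1 / 2) := by ring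
          _ ≤ _ := by gcongr
      · obtain ⟨l, rfl⟩ := Nat.exists_eq_add_of_le' hk
        rw [transition_add]
        calc _ ≤ ‖transition A (u + l) N‖ * ‖transition A u l‖ := norm_mul_le _ _
          _ ≤ (1 / 2) * (2 * e * b ^ N * ρ ^ l) :=
            mul_le_mul (ht₀ _ (by omega)).le (ih l (by omega) u hu) (norm_nonneg _) (by norm_num)
          _ = _ := by rw [pow_add, hρN]; ring
  refine ⟨(2 * e * b ^ N + 1) * (e * b ^ t₀) * (ρ ^ t₀)⁻¹, ρ, by positivity, hρ0, hρ1,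
    fun u k => ?_⟩
  rcases le_total k t₀ with hk | hk
  · have h1 : b ^ k ≤ b ^ t₀ := pow_le_pow_right₀ hb1 hk
    have h2 : ρ ^ t₀ ≤ ρ ^ k := pow_le_pow_of_le_one hρ0.le hρ1.le hk
    have h3 : 1 ≤ (ρ ^ t₀)⁻¹ * ρ ^ k := by
      rw [← div_eq_inv_mul]; exact (one_le_div (by positivity)).2 h2
    calc ‖transition A u k‖ ≤ e * b ^ k := hcrude u k
      _ ≤ 1 * (e * b ^ t₀) * 1 := by rw [one_mul, mul_one]; gcongr
      _ ≤ (2 * e * b ^ N + 1) * (e * b ^ t₀) * ((ρ ^ t₀)⁻¹ * ρ ^ k) := by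
        gcongr
        have : 0 ≤ 2 * e * b ^ N := by positivity
        linarith
      _ = _ := by ring
  · obtain ⟨l, rfl⟩ := Nat.exists_eq_add_of_le hk
    rw [transition_add]
    calc _ ≤ ‖transition A (u + t₀) l‖ * ‖transition A u t₀‖ := norm_mul_le _ _
      _ ≤ (2 * e * b ^ N * ρ ^ l) * (e * b ^ t₀) :=
        mul_le_mul (hlate l _ (by omega)) (hcrude _ _) (norm_nonneg _) (by positivity)
      _ ≤ ((2 * e * b ^ N + 1) * ρ ^ l) * (e * b ^ t₀) := by gcongr; linarith
      _ = _ := by rw [pow_add]; field_simp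

end Transition

/-! ### Limits of positive semidefinite matrices, controllability and observability -/

section Limits

variable {m r s : Type*} [Fintype m] [DecidableEq m] [Fintype s] [DecidableEq s]
  [Fintype r] [DecidableEq r]

open scoped MatrixOrder in
lemma exists_isUnit_mul_transpose_of_posDef {Q : Matrix r r ℝ} (hQ : Q.PosDef) :
    ∃ C : Matrix r r ℝ, IsUnit C.det ∧ Q = C * Cᵀ := by
  obtain ⟨C, rfl⟩ := CStarAlgebra.nonneg_iff_eq_star_mul_self.mp hQ.posSemidef.nonneg
  have h := (Matrix.isUnit_iff_isUnit_det _).1 hQ.isUnit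
  rw [Matrix.star_eq_conjTranspose, Matrix.conjTranspose_eq_transpose_of_trivial,
    Matrix.det_mul] at h
  refine ⟨Cᵀ, isUnit_of_mul_isUnit_left h, ?_⟩
  simp [Matrix.star_eq_conjTranspose]

omit [DecidableEq s] [Fintype s] [DecidableEq r] in
lemma tendsto_zero_of_diag_mul_transpose {Y : ℕ → Matrix s r ℝ}
    (h : ∀ i, Tendsto (fun n => (Y n * (Y n)ᵀ) i i) atTop (𝓝 0)) : Tendsto Y atTop (𝓝 0) := by
  refine tendsto_pi_nhds.2 fun i => tendsto_pi_nhds.2 fun j => ?_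
  have h2 : Tendsto (fun n => Y n i j ^ 2) atTop (𝓝 0) := by
    refine squeeze_zero (fun n => sq_nonneg _) (fun n => ?_) (h i)
    rw [Matrix.mul_apply]
    simp only [Matrix.transpose_apply, ← sq]
    exact Finset.single_le_sum (f := fun j => Y n i j ^ 2) (fun _ _ => sq_nonneg _)
      (Finset.mem_univ j)
  have h3 := (Real.continuous_sqrt.tendsto _).comp h2
  simp only [Function.comp_def, Real.sqrt_sq_eq_abs, Real.sqrt_zero] at h3
  exact (tendsto_zero_iff_abs_tendsto_zero _).2 h3

omit [DecidableEq s] [Fintype s] in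
lemma tendsto_zero_of_diag_mul_posDef_mul_transpose {Q : Matrix r r ℝ} (hQ : Q.PosDef)
    {X : ℕ → Matrix s r ℝ} (h : ∀ i, Tendsto (fun n => (X n * Q * (X n)ᵀ) i i) atTop (𝓝 0)) :
    Tendsto X atTop (𝓝 0) := by
  obtain ⟨C, hC, rfl⟩ := exists_isUnit_mul_transpose_of_posDef hQ
  have h1 : Tendsto (fun n => X n * C) atTop (𝓝 0) := by
    refine tendsto_zero_of_diag_mul_transpose fun i => ?_
    simpa only [Matrix.transpose_mul, Matrix.mul_assoc] using h i
  have hc : Continuous fun Y : Matrix s r ℝ => Y * C⁻¹ :=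
    Continuous.matrix_mul continuous_id continuous_const
  have h2 := (hc.tendsto 0).comp h1
  simpa [Function.comp_def, Matrix.mul_nonsing_inv_cancel_right _ _ hC] using h2

omit [DecidableEq s] in
lemma posSemidef_of_tendsto {P : ℕ → Matrix s s ℝ} {P₀ : Matrix s s ℝ}
    (h : Tendsto P atTop (𝓝 P₀)) (hP : ∀ t, (P t).PosSemidef) : P₀.PosSemidef := by
  refine Matrix.PosSemidef.of_dotProduct_mulVec_nonneg ?_ fun x => ?_
  · have h1 : Tendsto (fun t => (P t)ᴴ) atTop (𝓝 P₀ᴴ) :=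
      ((continuous_id.matrix_conjTranspose).tendsto P₀).comp h
    exact tendsto_nhds_unique h1 (by simpa only [(hP _).isHermitian.eq] using h)
  · have hc : Continuous fun P : Matrix s s ℝ => star x ⬝ᵥ P *ᵥ x :=
      continuous_const.dotProduct (continuous_id.matrix_mulVec continuous_const)
    exact ge_of_tendsto' ((hc.tendsto P₀).comp h) fun t => (hP t).dotProduct_mulVec_nonneg x

/-- Monotone convergence in the Loewner order: the quadratic forms converge, and polarization
recovers the entries. -/
lemma exists_tendsto_of_monotone_of_bounded {P : ℕ → Matrix s s ℝ} {D : Matrix s s ℝ}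
    (hsymm : ∀ t, (P t)ᵀ = P t) (hmono : ∀ t, (P (t + 1) - P t).PosSemidef)
    (hbdd : ∀ t, (D - P t).PosSemidef) : ∃ P₀, Tendsto P atTop (𝓝 P₀) := by
  have hquad : ∀ x : s → ℝ, ∃ c, Tendsto (fun t => x ⬝ᵥ P t *ᵥ x) atTop (𝓝 c) := by
    intro x
    refine ⟨_, tendsto_atTop_ciSup (monotone_nat_of_le_succ fun t => ?_) ⟨x ⬝ᵥ D *ᵥ x, ?_⟩⟩
    · have := (hmono t).dotProduct_mulVec_nonneg x
      simpa [Matrix.sub_mulVec, dotProduct_sub] using this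
    · rintro _ ⟨t, rfl⟩
      have := (hbdd t).dotProduct_mulVec_nonneg x
      simpa [Matrix.sub_mulVec, dotProduct_sub] using this
  choose q hq using hquad
  refine ⟨Matrix.of fun i j => (q (Pi.single i 1 + Pi.single j 1) - q (Pi.single i 1) -
    q (Pi.single j 1)) / 2, tendsto_pi_nhds.2 fun i => tendsto_pi_nhds.2 fun j => ?_⟩
  refine ((((hq (Pi.single i 1 + Pi.single j 1)).sub (hq (Pi.single i 1))).sub
    (hq (Pi.single j 1))).div_const 2).congr fun t => ?_
  have h1 : P t j i = P t i j := congrFun (congrFun (hsymm t) i) j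
  simp [Matrix.mulVec_add, add_dotProduct, dotProduct_add, h1]
  ring

omit [DecidableEq s] in
lemma tendsto_matrix_mul {l k : Type*} {A : ℕ → Matrix l s ℝ} {B : ℕ → Matrix s k ℝ}
    {A₀ : Matrix l s ℝ} {B₀ : Matrix s k ℝ} (hA : Tendsto A atTop (𝓝 A₀))
    (hB : Tendsto B atTop (𝓝 B₀)) : Tendsto (fun t => A t * B t) atTop (𝓝 (A₀ * B₀)) := by
  have hmul : Continuous fun p : Matrix l s ℝ × Matrix s k ℝ => p.1 * p.2 :=
    continuous_fst.matrix_mul continuous_snd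
  exact (hmul.tendsto (A₀, B₀)).comp (hA.prodMk_nhds hB)

omit [DecidableEq s] in
lemma tendsto_kalmanK {Z : Matrix m s ℝ} {Se : Matrix m m ℝ} {P : ℕ → Matrix s s ℝ}
    {P₀ : Matrix s s ℝ} (hSe : Se.PosDef) (h₀ : P₀.PosSemidef) (h : Tendsto P atTop (𝓝 P₀)) :
    Tendsto (fun t => kalmanK Z Se (P t)) atTop (𝓝 (kalmanK Z Se P₀)) := by
  have hF : Tendsto (fun t => kalmanF Z Se (P t)) atTop (𝓝 (kalmanF Z Se P₀)) :=
    (tendsto_matrix_mul (tendsto_matrix_mul tendsto_const_nhds h) tendsto_const_nhds).add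
      tendsto_const_nhds
  have hdet : (kalmanF Z Se P₀).det ≠ 0 := (kalmanF_posDef hSe h₀).det_pos.ne'
  have hinv : ContinuousAt Inv.inv (kalmanF Z Se P₀) := by
    refine continuousAt_matrix_inv _ ?_
    rw [Ring.inverse_eq_inv']
    exact continuousAt_inv₀ hdet
  have hF' : Tendsto (fun t => (kalmanF Z Se (P t))⁻¹) atTop (𝓝 (kalmanF Z Se P₀)⁻¹) :=
    hinv.tendsto.comp hF
  exact tendsto_matrix_mul (tendsto_matrix_mul h tendsto_const_nhds) hF'

lemma tendsto_kalmanL {Z : Matrix m s ℝ} {Se : Matrix m m ℝ} {P : ℕ → Matrix s s ℝ}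
    {P₀ : Matrix s s ℝ} (hSe : Se.PosDef) (h₀ : P₀.PosSemidef) (h : Tendsto P atTop (𝓝 P₀)) :
    Tendsto (fun t => kalmanL Z Se (P t)) atTop (𝓝 (kalmanL Z Se P₀)) := by
  have hc : Continuous fun K : Matrix s m ℝ => 1 - K * Z :=
    continuous_const.sub (continuous_id.matrix_mul continuous_const)
  exact (hc.tendsto _).comp (tendsto_kalmanK hSe h₀ h)

omit [DecidableEq m] in
/-- Observability, as a left inverse of the observability matrix written in blocks. -/
lemma exists_obsMatrix_left_inverse {Z : Matrix m s ℝ} {T : Matrix s s ℝ} {q : ℕ}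
    (h : (obsMatrix Z T q).rank = Fintype.card s) :
    ∃ H : ℕ → Matrix s m ℝ, ∑ k ∈ Finset.range q, H k * Z * T ^ k = 1 := by
  have hsurj : Function.Surjective (obsMatrix Z T q)ᵀ.mulVec := by
    have : LinearMap.range (obsMatrix Z T q)ᵀ.mulVecLin = ⊤ := by
      apply Submodule.eq_top_of_finrank_eq
      rw [← Matrix.rank, Matrix.rank_transpose, h, Module.finrank_fintype_fun_eq_card]
    exact LinearMap.range_eq_top.1 this
  obtain ⟨B, hB⟩ := Matrix.mulVec_surjective_iff_exists_right_inverse.1 hsurj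
  refine ⟨fun k => Matrix.of fun i j => if hk : k < q then B (⟨k, hk⟩, j) i else 0, ?_⟩
  have hB' : Bᵀ * obsMatrix Z T q = 1 := by
    rw [← Matrix.transpose_transpose (obsMatrix Z T q), ← Matrix.transpose_mul, hB,
      Matrix.transpose_one]
  rw [← hB', Finset.sum_range]
  ext i j
  rw [Matrix.sum_apply, Matrix.mul_apply, Fintype.sum_prod_type]
  refine Finset.sum_congr rfl fun k _ => ?_
  rw [Matrix.mul_assoc, Matrix.mul_apply]
  simp [obsMatrix]

omit [DecidableEq r] in
/-- Controllability, as a right inverse of the controllability matrix written in blocks. -/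
lemma exists_ctrlMatrix_right_inverse {T : Matrix s s ℝ} {R : Matrix s r ℝ} {q : ℕ}
    (h : (ctrlMatrix T R q).rank = Fintype.card s) :
    ∃ H : ℕ → Matrix r s ℝ, ∑ k ∈ Finset.range q, T ^ k * R * H k = 1 := by
  have hsurj : Function.Surjective (ctrlMatrix T R q).mulVec := by
    have : LinearMap.range (ctrlMatrix T R q).mulVecLin = ⊤ := by
      apply Submodule.eq_top_of_finrank_eq
      rw [← Matrix.rank, h, Module.finrank_fintype_fun_eq_card]
    exact LinearMap.range_eq_top.1 this
  obtain ⟨B, hB⟩ := Matrix.mulVec_surjective_iff_exists_right_inverse.1 hsurj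
  refine ⟨fun k => Matrix.of fun i j => if hk : k < q then B (⟨k, hk⟩, i) j else 0, ?_⟩
  rw [← hB, Finset.sum_range]
  ext i j
  rw [Matrix.sum_apply, Matrix.mul_apply, Fintype.sum_prod_type]
  refine Finset.sum_congr rfl fun k _ => ?_
  rw [Matrix.mul_apply]
  simp [ctrlMatrix]

end Limits

/-! ### Convergence of the Riccati recursion and stability of the limiting filter -/

section Convergence

variable {m s : Type*} [Fintype m] [DecidableEq m] [Fintype s] [DecidableEq s]
  {Z : Matrix m s ℝ} {T : Matrix s s ℝ} {Se : Matrix m m ℝ} {Sn P P₀ : Matrix s s ℝ}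

lemma Controllable.posSemidef (h : Controllable T Sn) : Sn.PosSemidef := by
  obtain ⟨r, R, Q, hQ, rfl, -⟩ := h
  exact posSemidef_mul_mul_transpose hQ.posSemidef R

lemma kalmanP_posSemidef (hSe : Se.PosDef) (hSn : Sn.PosSemidef) (hP₀ : P₀.PosSemidef) (t : ℕ) :
    (kalmanP Z T Se Sn P₀ t).PosSemidef := by
  induction t with
  | zero => exact hP₀
  | succ t ih => exact riccati_posSemidef hSe hSn ih

/-- `P_{t+j}` is at most the error covariance of the filter that uses arbitrary gains over the `j`
steps after `t`; the matrices `U i` are the gains propagated to the final time, and `W j` is the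
influence of the error at time `t`. -/
lemma kalmanP_le_of_gains (hSe : Se.PosDef) (hSn : Sn.PosSemidef) (hP₀ : P₀.PosSemidef)
    {W : ℕ → Matrix s s ℝ} {U : ℕ → Matrix s m ℝ} (hW₀ : W 0 = 1)
    (hW : ∀ j, W (j + 1) = W j * T - U j * Z) (t j : ℕ) :
    (W j * kalmanP Z T Se Sn P₀ t * (W j)ᵀ +
      ∑ i ∈ Finset.range j, (U i * Se * (U i)ᵀ + W i * Sn * (W i)ᵀ) -
        kalmanP Z T Se Sn P₀ (t + j)).PosSemidef := by
  induction j generalizing t with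
  | zero => simpa [hW₀] using Matrix.PosSemidef.zero
  | succ j ih =>
    have h1 := riccati_le (Z := Z) (T := T) (Sn := Sn) hSe
      (kalmanP_posSemidef (Z := Z) (T := T) hSe hSn hP₀ t) (W j) (U j)
    have h2 := ih (t + 1)
    rw [show t + 1 + j = t + (j + 1) by omega] at h2
    convert h1.add h2 using 1
    rw [hW, Finset.sum_range_succ, show kalmanP Z T Se Sn P₀ (t + 1) =
      riccati Z T Se Sn (kalmanP Z T Se Sn P₀ t) from rfl]
    abel

/-- Observability bounds `P_t` from above, by comparison with a dead-beat filter, which forgets the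
initial value after `q` steps. -/
lemma exists_kalmanP_le (hSe : Se.PosDef) (hSn : Sn.PosSemidef) (hP₀ : P₀.PosSemidef) {q : ℕ}
    (hobs : (obsMatrix Z T q).rank = Fintype.card s) :
    ∃ D : Matrix s s ℝ, ∀ t, (D - kalmanP Z T Se Sn P₀ (t + q)).PosSemidef := by
  obtain ⟨H, hH⟩ := exists_obsMatrix_left_inverse hobs
  -- With `U i = T ^ q * H (q - 1 - i)` the initial uncertainty is annihilated after `q` steps.
  set U : ℕ → Matrix s m ℝ := fun i => T ^ q * H (q - 1 - i) with hU
  set W : ℕ → Matrix s s ℝ :=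
    fun j => T ^ j - ∑ i ∈ Finset.range j, U i * Z * T ^ (j - 1 - i) with hWdef
  have hW₀ : W 0 = 1 := by simp [hWdef]
  have hW : ∀ j, W (j + 1) = W j * T - U j * Z := by
    intro j
    simp only [hWdef]
    rw [Finset.sum_range_succ, Matrix.sub_mul, ← pow_succ, Finset.sum_mul, sub_sub]
    congr 2
    · refine Finset.sum_congr rfl fun i hi => ?_
      have : j + 1 - 1 - i = j - 1 - i + 1 := by have := Finset.mem_range.1 hi; omega
      rw [this, pow_succ, Matrix.mul_assoc (U i * Z)]
    · simp
  have hWq : W q = 0 := by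
    have h1 : ∑ i ∈ Finset.range q, U i * Z * T ^ (q - 1 - i) = T ^ q := by
      calc _ = ∑ i ∈ Finset.range q, T ^ q * (H (q - 1 - i) * Z * T ^ (q - 1 - i)) := by
            simp only [hU, Matrix.mul_assoc]
        _ = T ^ q * ∑ i ∈ Finset.range q, H i * Z * T ^ i := by
            rw [← Finset.mul_sum, Finset.sum_range_reflect (fun i => H i * Z * T ^ i)]
        _ = T ^ q := by rw [hH, Matrix.mul_one]
    simp only [hWdef, h1, sub_self]
  refine ⟨∑ i ∈ Finset.range q, (U i * Se * (U i)ᵀ + W i * Sn * (W i)ᵀ), fun t => ?_⟩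
  have h := kalmanP_le_of_gains hSe hSn hP₀ hW₀ hW t q
  rwa [hWq, Matrix.zero_mul, Matrix.zero_mul, zero_add] at h

lemma kalmanP_zero_mono (hSe : Se.PosDef) (hSn : Sn.PosSemidef) (t : ℕ) :
    (kalmanP Z T Se Sn 0 (t + 1) - kalmanP Z T Se Sn 0 t).PosSemidef := by
  have h := kalmanP_posSemidef (Z := Z) (T := T) hSe hSn Matrix.PosSemidef.zero
  induction t with
  | zero => simpa only [kalmanP, sub_zero] using h 1
  | succ t ih => exact riccati_mono hSe (h t) (h (t + 1)) ih

/-- Started at `0`, the Riccati recursion increases and is bounded, so it converges to a fixed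
point. -/
lemma exists_tendsto_kalmanP_zero (hSe : Se.PosDef) (hSn : Sn.PosSemidef) {q : ℕ}
    (hobs : (obsMatrix Z T q).rank = Fintype.card s) :
    ∃ P' : Matrix s s ℝ, P'.PosSemidef ∧ riccati Z T Se Sn P' = P' ∧
      Tendsto (kalmanP Z T Se Sn 0) atTop (𝓝 P') := by
  have hpsd := kalmanP_posSemidef (Z := Z) (T := T) hSe hSn Matrix.PosSemidef.zero
  obtain ⟨D, hD⟩ := exists_kalmanP_le (Z := Z) (T := T) hSe hSn Matrix.PosSemidef.zero hobs
  have hmono := kalmanP_zero_mono (Z := Z) (T := T) hSe hSn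
  have hadd : ∀ t k, (kalmanP Z T Se Sn 0 (t + k) - kalmanP Z T Se Sn 0 t).PosSemidef := by
    intro t k
    induction k with
    | zero => simpa using Matrix.PosSemidef.zero
    | succ k ih => simpa [← add_assoc] using (hmono (t + k)).add ih
  obtain ⟨P', hP'⟩ := exists_tendsto_of_monotone_of_bounded (D := D)
    (fun t => transpose_eq_self_of_posSemidef (hpsd t)) hmono
    (fun t => by simpa using (hD t).add (hadd t q))
  have h0 := posSemidef_of_tendsto hP' hpsd
  refine ⟨P', h0, ?_, hP'⟩
  have hL := tendsto_kalmanL (Z := Z) hSe h0 hP'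
  have hLt : Tendsto (fun t => (kalmanL Z Se (kalmanP Z T Se Sn 0 t))ᵀ) atTop
      (𝓝 (kalmanL Z Se P')ᵀ) := ((continuous_id.matrix_transpose).tendsto _).comp hL
  have h1 : Tendsto (fun t => kalmanP Z T Se Sn 0 (t + 1)) atTop (𝓝 (riccati Z T Se Sn P')) :=
    (tendsto_matrix_mul (tendsto_matrix_mul (tendsto_matrix_mul tendsto_const_nhds hP') hLt)
      tendsto_const_nhds).add tendsto_const_nhds
  exact tendsto_nhds_unique h1 (hP'.comp (tendsto_add_atTop_nat 1))

/-- The closed-loop matrix `A = T L` of a positive semidefinite fixed point is stable. With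
`G = T K` and `Σ_η = R Q Rᵀ`, iterating the Joseph form bounds the series
`∑ Aᵏ (G Σ_ε Gᵀ + R Q Rᵀ) (Aᵏ)ᵀ` by `P`, whence `Aᵏ G → 0` and `Aᵏ R → 0`. As `T = A + G Z`, also
`Aᵏ Tʲ R → 0` for every `j`, and by controllability the columns of the `Tʲ R` span the space. -/
lemma tendsto_pow_of_riccati_fixed (hSe : Se.PosDef) (hP : P.PosSemidef)
    (hctrl : Controllable T Sn) (hfix : riccati Z T Se Sn P = P) :
    Tendsto (fun k => (T * kalmanL Z Se P) ^ k) atTop (𝓝 0) := by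
  obtain ⟨r, R, Q, hQ, hSn, hR⟩ := hctrl
  set A := T * kalmanL Z Se P with hA
  set G := T * kalmanK Z Se P with hG
  have hT : T = A + G * Z := by
    rw [hA, hG, kalmanL, Matrix.mul_sub, Matrix.mul_one, ← Matrix.mul_assoc, sub_add_cancel]
  have hlyap : P = A * P * Aᵀ + (G * Se * Gᵀ + R * Q * Rᵀ) := by
    rw [← hSn, hA, hG, ← riccati_eq_joseph hSe hP, hfix]
  have hGpsd : ∀ k, (A ^ k * G * Se * (A ^ k * G)ᵀ).PosSemidef := fun k =>
    posSemidef_mul_mul_transpose hSe.posSemidef _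
  have hRpsd : ∀ k, (A ^ k * R * Q * (A ^ k * R)ᵀ).PosSemidef := fun k =>
    posSemidef_mul_mul_transpose hQ.posSemidef _
  -- The `n`-fold iterate of `hlyap`.
  have hsum : ∀ n, P = A ^ n * P * (A ^ n)ᵀ + ∑ k ∈ Finset.range n,
      (A ^ k * G * Se * (A ^ k * G)ᵀ + A ^ k * R * Q * (A ^ k * R)ᵀ) := by
    intro n
    induction n with
    | zero => simp
    | succ n ih =>
      have : A ^ n * P * (A ^ n)ᵀ = A ^ (n + 1) * P * (A ^ (n + 1))ᵀ +
          (A ^ n * G * Se * (A ^ n * G)ᵀ + A ^ n * R * Q * (A ^ n * R)ᵀ) := by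
        conv_lhs => rw [hlyap]
        simp only [pow_succ, Matrix.transpose_mul, Matrix.mul_add, Matrix.add_mul,
          Matrix.mul_assoc]
      conv_lhs => rw [ih, this]
      rw [Finset.sum_range_succ]
      abel
  have hdiag : ∀ i, Tendsto (fun k : ℕ => (A ^ k * G * Se * (A ^ k * G)ᵀ) i i +
      (A ^ k * R * Q * (A ^ k * R)ᵀ) i i) atTop (𝓝 0) := by
    intro i
    refine (summable_of_sum_range_le (c := P i i)
      (fun k => add_nonneg ((hGpsd k).diag_nonneg) ((hRpsd k).diag_nonneg))
      fun n => ?_).tendsto_atTop_zero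
    have h1 := congrFun (congrFun (hsum n) i) i
    rw [Matrix.add_apply, Matrix.sum_apply] at h1
    have h2 : 0 ≤ (A ^ n * P * (A ^ n)ᵀ) i i := (posSemidef_mul_mul_transpose hP _).diag_nonneg
    simp only [Matrix.add_apply] at h1
    linarith
  have hAG : Tendsto (fun k => A ^ k * G) atTop (𝓝 0) :=
    tendsto_zero_of_diag_mul_posDef_mul_transpose hSe fun i =>
      squeeze_zero (fun k => (hGpsd k).diag_nonneg)
        (fun k => le_add_of_nonneg_right (hRpsd k).diag_nonneg) (hdiag i)
  have hAR : Tendsto (fun k => A ^ k * R) atTop (𝓝 0) :=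
    tendsto_zero_of_diag_mul_posDef_mul_transpose hQ fun i =>
      squeeze_zero (fun k => (hRpsd k).diag_nonneg)
        (fun k => le_add_of_nonneg_left (hGpsd k).diag_nonneg) (hdiag i)
  have hATR : ∀ j, Tendsto (fun k => A ^ k * (T ^ j * R)) atTop (𝓝 0) := by
    intro j
    induction j with
    | zero => simpa using hAR
    | succ j ih =>
      have h1 := (ih.comp (tendsto_add_atTop_nat 1)).add
        (tendsto_matrix_mul hAG (tendsto_const_nhds (x := Z * (T ^ j * R))))
      rw [Matrix.zero_mul, add_zero] at h1
      refine h1.congr fun k => ?_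
      have h2 : T ^ (j + 1) * R = A * (T ^ j * R) + G * (Z * (T ^ j * R)) := by
        rw [pow_succ', Matrix.mul_assoc, ← Matrix.mul_assoc G, ← Matrix.add_mul, ← hT]
      rw [h2, Matrix.mul_add, Function.comp_apply, pow_succ]
      simp only [Matrix.mul_assoc]
  obtain ⟨H, hH⟩ := exists_ctrlMatrix_right_inverse hR
  have h1 : Tendsto (fun k => ∑ j ∈ Finset.range (Fintype.card s), A ^ k * (T ^ j * R) * H j)
      atTop (𝓝 (∑ j ∈ Finset.range (Fintype.card s), (0 : Matrix s (Fin r) ℝ) * H j)) :=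
    tendsto_finsetSum _ fun j _ => tendsto_matrix_mul (hATR j) tendsto_const_nhds
  simp only [Matrix.zero_mul, Finset.sum_const_zero] at h1
  refine h1.congr fun k => ?_
  simp only [Matrix.mul_assoc]
  rw [← Matrix.mul_sum]
  simp only [← Matrix.mul_assoc] at hH ⊢
  rw [hH, Matrix.mul_one]

lemma kalmanP_sub_kalmanP {P₁ P₂ : Matrix s s ℝ} (hSe : Se.PosDef) (hSn : Sn.PosSemidef)
    (h₁ : P₁.PosSemidef) (h₂ : P₂.PosSemidef) (t : ℕ) :
    kalmanP Z T Se Sn P₁ t - kalmanP Z T Se Sn P₂ t =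
      transition (fun t => T * kalmanL Z Se (kalmanP Z T Se Sn P₁ t)) 0 t * (P₁ - P₂) *
        (transition (fun t => T * kalmanL Z Se (kalmanP Z T Se Sn P₂ t)) 0 t)ᵀ := by
  induction t with
  | zero => simp [transition, kalmanP]
  | succ t ih =>
    have h := riccati_sub_riccati (Z := Z) (T := T) (Sn := Sn) hSe
      (kalmanP_posSemidef (Z := Z) (T := T) hSe hSn h₁ t)
      (kalmanP_posSemidef (Z := Z) (T := T) hSe hSn h₂ t)
    refine h.trans ?_
    rw [ih, transition, transition, zero_add]
    simp only [Matrix.transpose_mul, Matrix.mul_assoc]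

open scoped Matrix.Norms.Frobenius in
/-- The Riccati recursion converges to a matrix with stable closed loop, from every initial value
whose closed-loop products are bounded: these bound one factor of the difference from the recursion
started at `0`, and the other factor tends to `0`. -/
theorem exists_kalman_limit (hSe : Se.PosDef) (hctrl : Controllable T Sn) (hP₀ : P₀.PosSemidef)
    {q : ℕ} (hobs : (obsMatrix Z T q).rank = Fintype.card s)
    {C : ℝ} (hC : ∀ k, ‖transition (fun t => T * kalmanL Z Se (kalmanP Z T Se Sn P₀ t)) 0 k‖ ≤ C) :
    ∃ P' : Matrix s s ℝ, P'.PosSemidef ∧ Tendsto (kalmanP Z T Se Sn P₀) atTop (𝓝 P') ∧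
      Tendsto (fun k => (T * kalmanL Z Se P') ^ k) atTop (𝓝 0) := by
  have hSn := hctrl.posSemidef
  obtain ⟨P', hP', hfix, hlim⟩ := exists_tendsto_kalmanP_zero hSe hSn hobs
  have hpow := tendsto_pow_of_riccati_fixed hSe hP' hctrl hfix
  refine ⟨P', hP', ?_, hpow⟩
  have hA : Tendsto (fun t => T * kalmanL Z Se (kalmanP Z T Se Sn 0 t)) atTop
      (𝓝 (T * kalmanL Z Se P')) :=
    tendsto_matrix_mul tendsto_const_nhds (tendsto_kalmanL hSe hP' hlim)
  obtain ⟨D, ρ, hD, hρ0, hρ1, hbound⟩ := exists_norm_transition_le_geometric hA hpow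
  have hdiff : Tendsto (fun t => kalmanP Z T Se Sn P₀ t - kalmanP Z T Se Sn 0 t) atTop (𝓝 0) := by
    have hz : Tendsto (fun t : ℕ => C * ‖P₀‖ * (D * ρ ^ t)) atTop (𝓝 0) := by
      simpa using ((tendsto_pow_atTop_nhds_zero_of_lt_one hρ0.le hρ1).const_mul D).const_mul
        (C * ‖P₀‖)
    refine squeeze_zero_norm (fun t => ?_) hz
    rw [kalmanP_sub_kalmanP hSe hSn hP₀ Matrix.PosSemidef.zero, sub_zero]
    calc _ ≤ ‖transition (fun t => T * kalmanL Z Se (kalmanP Z T Se Sn P₀ t)) 0 t * P₀‖ *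
          ‖(transition (fun t => T * kalmanL Z Se (kalmanP Z T Se Sn 0 t)) 0 t)ᵀ‖ := norm_mul_le _ _
      _ ≤ (C * ‖P₀‖) * (D * ρ ^ t) := by
        rw [Matrix.frobenius_norm_transpose]
        refine mul_le_mul ((norm_mul_le _ _).trans ?_) (hbound 0 t) (norm_nonneg _)
          (mul_nonneg ((norm_nonneg _).trans (hC 0)) (norm_nonneg _))
        exact mul_le_mul_of_nonneg_right (hC t) (norm_nonneg _)
  simpa using hdiff.add hlim

open scoped Matrix.Norms.Frobenius in
/-- The Lyapunov recursion `S (t + 1) = A t * S t * (A t)ᵀ + W t` with convergent `W` and `A`, the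
limit of `A` being stable, converges. The solution is written as a series whose `k`-th term is the
contribution of the noise `k + 1` steps earlier, and dominated convergence applies. -/
theorem exists_tendsto_of_lyapunov_recursion {A W S : ℕ → Matrix s s ℝ} {A₀ W₀ : Matrix s s ℝ}
    (hA : Tendsto A atTop (𝓝 A₀)) (hpow : Tendsto (fun k => A₀ ^ k) atTop (𝓝 0))
    (hW : Tendsto W atTop (𝓝 W₀)) (hS : ∀ t, S (t + 1) = A t * S t * (A t)ᵀ + W t) :
    ∃ S₀, Tendsto S atTop (𝓝 S₀) := by
  obtain ⟨C, ρ, hC, hρ0, hρ1, hbound⟩ := exists_norm_transition_le_geometric hA hpow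
  obtain ⟨w, hw⟩ := hW.norm.bddAbove_range
  have hw' : ∀ t, ‖W t‖ ≤ w := fun t => hw ⟨t, rfl⟩
  have hw0 : 0 ≤ w := (norm_nonneg _).trans (hw' 0)
  set f : ℕ → ℕ → Matrix s s ℝ := fun t k => if k < t then
    transition A (t - k) k * W (t - 1 - k) * (transition A (t - k) k)ᵀ else 0 with hf
  have hexp : ∀ t, S t = transition A 0 t * S 0 * (transition A 0 t)ᵀ +
      ∑ u ∈ Finset.range t, transition A (u + 1) (t - 1 - u) * W u *
        (transition A (u + 1) (t - 1 - u))ᵀ := by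
    intro t
    induction t with
    | zero => simp [transition]
    | succ t ih =>
      rw [hS, ih, Finset.sum_range_succ, Matrix.mul_add, Matrix.add_mul, Finset.mul_sum,
        Finset.sum_mul, add_assoc]
      congr 1
      · simp only [transition, zero_add, Matrix.transpose_mul, Matrix.mul_assoc]
      · congr 1
        · refine Finset.sum_congr rfl fun u hu => ?_
          have hu := Finset.mem_range.1 hu
          rw [show t + 1 - 1 - u = t - 1 - u + 1 by omega, transition,
            show u + 1 + (t - 1 - u) = t by omega]
          simp only [Matrix.transpose_mul, Matrix.mul_assoc]
        · simp [transition]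
  have htsum : ∀ t, S t = transition A 0 t * S 0 * (transition A 0 t)ᵀ + ∑' k, f t k := by
    intro t
    rw [hexp t, tsum_eq_sum (s := Finset.range t)
      (fun k hk => if_neg (by simpa using hk)), ← Finset.sum_range_reflect]
    congr 1
    refine Finset.sum_congr rfl fun k hk => ?_
    have hk := Finset.mem_range.1 hk
    simp only [if_pos hk]
    rw [show t - 1 - k + 1 = t - k by omega, show t - 1 - (t - 1 - k) = k by omega]
  have hmul3 : ∀ X Y : Matrix s s ℝ, ∀ k : ℕ, ‖X‖ ≤ C * ρ ^ k →
      ‖X * Y * Xᵀ‖ ≤ C * ρ ^ k * ‖Y‖ * (C * ρ ^ k) := by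
    intro X Y k hX
    have h0 : 0 ≤ C * ρ ^ k := by positivity
    calc ‖X * Y * Xᵀ‖ ≤ ‖X‖ * ‖Y‖ * ‖Xᵀ‖ :=
          (norm_mul_le _ _).trans (mul_le_mul_of_nonneg_right (norm_mul_le _ _) (norm_nonneg _))
      _ ≤ _ := by rw [Matrix.frobenius_norm_transpose]; gcongr
  have h1 : Tendsto (fun t => transition A 0 t * S 0 * (transition A 0 t)ᵀ) atTop (𝓝 0) := by
    have hz : Tendsto (fun t : ℕ => C * ρ ^ t * ‖S 0‖ * (C * ρ ^ t)) atTop (𝓝 0) := by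
      have := (tendsto_pow_atTop_nhds_zero_of_lt_one hρ0.le hρ1).const_mul C
      simpa using (this.mul_const ‖S 0‖).mul this
    exact squeeze_zero_norm (fun t => hmul3 _ _ t (hbound 0 t)) hz
  have : CompleteSpace (Matrix s s ℝ) := FiniteDimensional.complete ℝ _
  have h2 : Tendsto (fun t => ∑' k, f t k) atTop (𝓝 (∑' k, A₀ ^ k * W₀ * (A₀ ^ k)ᵀ)) := by
    refine tendsto_tsum_of_dominated_convergence (bound := fun k => C * C * w * (ρ * ρ) ^ k)
      ((summable_geometric_of_lt_one (by positivity) (by nlinarith)).mul_left _) (fun k => ?_)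
      (Eventually.of_forall fun t k => ?_)
    · have hΦ : Tendsto (fun t => transition A (t - k) k) atTop (𝓝 (A₀ ^ k)) :=
        (tendsto_transition hA k).comp (tendsto_sub_atTop_nat k)
      have hWk : Tendsto (fun t => W (t - 1 - k)) atTop (𝓝 W₀) :=
        hW.comp ((tendsto_sub_atTop_nat k).comp (tendsto_sub_atTop_nat 1))
      have hΦt : Tendsto (fun t => (transition A (t - k) k)ᵀ) atTop (𝓝 (A₀ ^ k)ᵀ) :=
        ((continuous_id.matrix_transpose).tendsto _).comp hΦ
      refine (tendsto_matrix_mul (tendsto_matrix_mul hΦ hWk) hΦt).congr' ?_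
      filter_upwards [eventually_gt_atTop k] with t ht
      simp only [hf, if_pos ht]
    · simp only [hf]
      split_ifs
      · calc _ ≤ C * ρ ^ k * ‖W (t - 1 - k)‖ * (C * ρ ^ k) := hmul3 _ _ k (hbound _ k)
          _ ≤ C * ρ ^ k * w * (C * ρ ^ k) := by gcongr; exact hw' _
          _ = _ := by rw [mul_pow]; ring
      · rw [norm_zero]; positivity
  refine ⟨_, (h1.add h2).congr fun t => (htsum t).symm⟩

end Convergence

/-! ### Fourth moments of Gaussian variables -/

section GaussianMoments

variable {Ω : Type*} [MeasurableSpace Ω] {μ : Measure Ω} {X Y : Ω → ℝ}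

/-- Affine combinations of a Gaussian process are Gaussian. -/
lemma hasGaussianLaw_of_mem_span {ι : Type*} {W : ι → Ω → ℝ} (hW : IsGaussianProcess W μ)
    {f : Ω → ℝ} (hf : f ∈ Submodule.span ℝ (insert (fun _ => (1 : ℝ)) (Set.range W))) :
    HasGaussianLaw f μ := by
  obtain ⟨a, z, hz, rfl⟩ := Submodule.mem_span_insert.1 hf
  obtain ⟨c, rfl⟩ := Finsupp.mem_span_range_iff_exists_finsupp.1 hz
  set L : (c.support → ℝ) →L[ℝ] ℝ := ∑ i : c.support, c i • ContinuousLinearMap.proj i with hL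
  have h1 := (hW.hasGaussianLaw c.support).map_fun L
  have h2 := h1.isGaussian_map
  have h3 : IsGaussian ((μ.map fun ω => L (c.support.restrict (W · ω))).map (· + a)) :=
    inferInstance
  rw [AEMeasurable.map_map_of_aemeasurable (by fun_prop) h1.aemeasurable] at h3
  have h4 : ((· + a) ∘ fun ω => L (c.support.restrict (W · ω))) =
      a • (fun _ : Ω => (1 : ℝ)) + c.sum fun i b => b • W i := by
    ext ω
    simp only [hL, Function.comp_apply, Pi.add_apply, Pi.smul_apply, smul_eq_mul, mul_one,
      Finsupp.sum, Finset.sum_apply]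
    rw [add_comm, ← Finset.sum_coe_sort c.support]
    simp
  rw [h4] at h3
  exact ⟨h3⟩

lemma integrable_pow_of_hasGaussianLaw (hX : HasGaussianLaw X μ) (n : ℕ) :
    Integrable (fun ω => X ω ^ n) μ := by
  have := hX.isProbabilityMeasure
  have h : MemLp X n μ := hX.memLp (by simp)
  refine (h.integrable_norm_pow').mono' (hX.aemeasurable.pow_const n).aestronglyMeasurable ?_
  exact Eventually.of_forall fun ω => by simp

lemma memLp_sq_of_hasGaussianLaw (hX : HasGaussianLaw X μ) :
    MemLp (fun ω => X ω ^ 2) 2 μ := by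
  refine (memLp_two_iff_integrable_sq (hX.aemeasurable.pow_const 2).aestronglyMeasurable).2 ?_
  simpa only [← pow_mul] using integrable_pow_of_hasGaussianLaw hX 4

/-- The fourth moment, as the fourth derivative at `0` of the moment generating function. -/
lemma integral_pow_four_of_hasGaussianLaw (hX : HasGaussianLaw X μ) :
    ∫ ω, X ω ^ 4 ∂μ = μ[X] ^ 4 + 6 * μ[X] ^ 2 * Var[X; μ] + 3 * Var[X; μ] ^ 2 := by
  set a := μ[X]
  set v := Var[X; μ] with hv
  have hv0 : ((v.toNNReal : NNReal) : ℝ) = v := Real.coe_toNNReal _ (variance_nonneg _ _)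
  have hmap : μ.map X = gaussianReal a v.toNNReal := hX.map_eq_gaussianReal
  have hmgf : mgf X μ = fun t => Real.exp (a * t + v * t ^ 2 / 2) := by
    ext t; rw [mgf_gaussianReal hmap, hv0]
  have hset : integrableExpSet X μ = Set.univ := by
    ext t
    simp only [Set.mem_univ, iff_true]
    by_contra hnot
    have h0 : mgf X μ t = 0 := integral_undef hnot
    rw [hmgf] at h0
    exact (Real.exp_pos _).ne' h0
  have h4 := iteratedDeriv_mgf_zero (X := X) (μ := μ) (by simp [hset]) 4
  rw [show ∫ ω, X ω ^ 4 ∂μ = μ[X ^ 4] from rfl, ← h4, hmgf]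
  -- Differentiating `p * exp` for a polynomial `p` four times, starting from `p = 1`.
  have hd : ∀ {p p' : ℝ → ℝ}, (∀ t, HasDerivAt p (p' t) t) →
      deriv (fun t => p t * Real.exp (a * t + v * t ^ 2 / 2)) =
        fun t => (p' t + p t * (a + v * t)) * Real.exp (a * t + v * t ^ 2 / 2) := by
    intro p p' hp
    ext t
    have he : HasDerivAt (fun t : ℝ => a * t + v * t ^ 2 / 2) (a + v * t) t := by
      have := ((hasDerivAt_id t).const_mul a).add (((hasDerivAt_pow 2 t).const_mul v).div_const 2)
      exact this.congr_deriv (by simp; ring)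
    have hm : HasDerivAt (fun t => p t * Real.exp (a * t + v * t ^ 2 / 2)) _ t :=
      (hp t).mul he.exp
    rw [hm.deriv]
    ring
  have hl : ∀ t, HasDerivAt (fun t : ℝ => a + v * t) v t := fun t => by
    simpa using ((hasDerivAt_id t).const_mul v).const_add a
  have e0 : (fun t => Real.exp (a * t + v * t ^ 2 / 2)) =
      fun t => (fun _ => (1 : ℝ)) t * Real.exp (a * t + v * t ^ 2 / 2) := by simp
  have hp1 : ∀ t : ℝ, HasDerivAt (fun t : ℝ => 0 + 1 * (a + v * t)) v t := fun t => by
    simpa using hl t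
  have hp2 : ∀ t : ℝ, HasDerivAt (fun t : ℝ => v + (0 + 1 * (a + v * t)) * (a + v * t))
      (v * (a + v * t) + (0 + 1 * (a + v * t)) * v) t := fun t =>
    ((hp1 t).mul (hl t)).const_add v
  have hp3 : ∀ t : ℝ, HasDerivAt (fun t : ℝ => v * (a + v * t) + (0 + 1 * (a + v * t)) * v +
      (v + (0 + 1 * (a + v * t)) * (a + v * t)) * (a + v * t)) _ t := fun t =>
    (((hl t).const_mul v).add ((hp1 t).mul_const v)).add ((hp2 t).mul (hl t))
  rw [iteratedDeriv_succ, iteratedDeriv_succ, iteratedDeriv_succ, iteratedDeriv_succ,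
    iteratedDeriv_zero, e0, hd (fun t => hasDerivAt_const t (1 : ℝ)), hd hp1, hd hp2, hd hp3]
  simp
  ring

/-- Isserlis' formula for two squares. Polarization expresses `X² Y²` by the fourth powers of `X + Y`,
`X - Y`, `X` and `Y`, so that only univariate Gaussian moments enter. -/
lemma covariance_sq_sq_of_hasGaussianLaw (hX : HasGaussianLaw X μ) (hY : HasGaussianLaw Y μ)
    (hadd : HasGaussianLaw (X + Y) μ) (hsub : HasGaussianLaw (X - Y) μ) :
    cov[fun ω => X ω ^ 2, fun ω => Y ω ^ 2; μ] =
      2 * cov[X, Y; μ] ^ 2 + 4 * μ[X] * μ[Y] * cov[X, Y; μ] := by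
  have := hX.isProbabilityMeasure
  have hX2 := hX.memLp_two
  have hY2 := hY.memLp_two
  rw [covariance_eq_sub (memLp_sq_of_hasGaussianLaw hX) (memLp_sq_of_hasGaussianLaw hY)]
  have hsq : ∀ {f : Ω → ℝ}, HasGaussianLaw f μ →
      ∫ ω, f ω ^ 2 ∂μ = Var[f; μ] + μ[f] ^ 2 := fun hf => by
    rw [variance_eq_sub hf.memLp_two]; simp
  have i1 := integrable_pow_of_hasGaussianLaw hadd 4
  have i2 := integrable_pow_of_hasGaussianLaw hsub 4
  have i3 := integrable_pow_of_hasGaussianLaw hX 4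
  have i4 := integrable_pow_of_hasGaussianLaw hY 4
  have i5 : Integrable (fun ω => (X + Y) ω ^ 4 + (X - Y) ω ^ 4) μ := i1.add i2
  have i6 : Integrable (fun ω => (X + Y) ω ^ 4 + (X - Y) ω ^ 4 - 2 * X ω ^ 4) μ :=
    i5.sub (i3.const_mul 2)
  have hprod : μ[(fun ω => X ω ^ 2) * fun ω => Y ω ^ 2] =
      (∫ ω, (X + Y) ω ^ 4 ∂μ + ∫ ω, (X - Y) ω ^ 4 ∂μ - 2 * ∫ ω, X ω ^ 4 ∂μ
        - 2 * ∫ ω, Y ω ^ 4 ∂μ) / 12 := by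
    rw [← integral_const_mul, ← integral_const_mul, ← integral_add i1 i2,
      ← integral_sub i5 (i3.const_mul 2),
      ← integral_sub i6 (i4.const_mul 2), ← integral_div]
    congr 1
    ext ω
    simp only [Pi.mul_apply, Pi.add_apply, Pi.sub_apply]
    ring
  have m1 : μ[X + Y] = μ[X] + μ[Y] := integral_add hX.integrable hY.integrable
  have m2 : μ[X - Y] = μ[X] - μ[Y] := integral_sub hX.integrable hY.integrable
  rw [hprod, hsq hX, hsq hY, integral_pow_four_of_hasGaussianLaw hadd,
    integral_pow_four_of_hasGaussianLaw hsub, integral_pow_four_of_hasGaussianLaw hX,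
    integral_pow_four_of_hasGaussianLaw hY, m1, m2, variance_add hX2 hY2, variance_sub hX2 hY2]
  ring

end GaussianMoments

/-! ### Averages of squares of a Gaussian sequence -/

section SumsOfSquares

/-- The exponent `(u - t) + (t - u)`, with truncated subtraction, is the distance of `t` and `u`. -/
lemma sum_pow_dist_le {ρ : ℝ} (hρ0 : 0 ≤ ρ) (hρ1 : ρ < 1) (I : Finset ℕ) (u : ℕ) :
    ∑ t ∈ I, ρ ^ ((u - t) + (t - u)) ≤ 2 * (1 - ρ)⁻¹ := by
  have key : ∀ J : Finset ℕ, Set.InjOn (fun t => (u - t) + (t - u)) J →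
      ∑ t ∈ J, ρ ^ ((u - t) + (t - u)) ≤ (1 - ρ)⁻¹ := by
    intro J hJ
    rw [← Finset.sum_image (f := fun k => ρ ^ k) hJ, ← tsum_geometric_of_lt_one hρ0 hρ1]
    exact (summable_geometric_of_lt_one hρ0 hρ1).sum_le_tsum _ fun _ _ => by positivity
  rw [← Finset.sum_filter_add_sum_filter_not I (fun t => t ≤ u), two_mul]
  refine add_le_add (key _ ?_) (key _ ?_)
  · intro a ha b hb hab
    have h1 := (Finset.mem_filter.1 ha).2
    have h2 := (Finset.mem_filter.1 hb).2
    simp only at hab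
    omega
  · intro a ha b hb hab
    have h1 := (Finset.mem_filter.1 ha).2
    have h2 := (Finset.mem_filter.1 hb).2
    simp only at hab
    omega

variable {Ω : Type*} [MeasurableSpace Ω] {μ : Measure Ω}

/-- For a Gaussian sequence with geometrically decaying autocovariances and bounded means, the
variance of a sum of squares is at most proportional to the number of summands. -/
lemma variance_sum_sq_le [IsProbabilityMeasure μ] {q : ℕ → Ω → ℝ} {C B ρ : ℝ} (hB : 0 ≤ B)
    (hρ0 : 0 < ρ) (hρ1 : ρ < 1) (hq : ∀ t, HasGaussianLaw (q t) μ)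
    (hadd : ∀ t u, HasGaussianLaw (q t + q u) μ) (hsub : ∀ t u, HasGaussianLaw (q t - q u) μ)
    (hcov : ∀ t k, |cov[q (t + k), q t; μ]| ≤ C * ρ ^ k) (hmean : ∀ t, |μ[q t]| ≤ B)
    (I : Finset ℕ) :
    Var[fun ω => ∑ t ∈ I, q t ω ^ 2; μ] ≤
      I.card * ((2 * C ^ 2 + 4 * B ^ 2 * C) * (2 * (1 - ρ)⁻¹)) := by
  have hC : 0 ≤ C := by simpa using (abs_nonneg _).trans (hcov 0 0)
  have hcov' : ∀ t u, |cov[q t, q u; μ]| ≤ C * ρ ^ ((t - u) + (u - t)) := by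
    intro t u
    rcases le_total u t with h | h
    · obtain ⟨k, rfl⟩ := Nat.exists_eq_add_of_le h
      simpa using hcov u k
    · obtain ⟨k, rfl⟩ := Nat.exists_eq_add_of_le h
      rw [covariance_comm]
      simpa using hcov t k
  have hterm : ∀ t u, cov[fun ω => q t ω ^ 2, fun ω => q u ω ^ 2; μ] ≤
      (2 * C ^ 2 + 4 * B ^ 2 * C) * ρ ^ ((t - u) + (u - t)) := by
    intro t u
    rw [covariance_sq_sq_of_hasGaussianLaw (hq t) (hq u) (hadd t u) (hsub t u)]
    set r := ρ ^ ((t - u) + (u - t))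
    have hr0 : 0 ≤ r := by positivity
    have hr1 : r ≤ 1 := pow_le_one₀ hρ0.le hρ1.le
    have h1 : cov[q t, q u; μ] ^ 2 ≤ C ^ 2 * r := by
      calc cov[q t, q u; μ] ^ 2 = |cov[q t, q u; μ]| ^ 2 := (sq_abs _).symm
        _ ≤ (C * r) ^ 2 := by gcongr; exact hcov' t u
        _ = C ^ 2 * (r * r) := by ring
        _ ≤ C ^ 2 * (r * 1) := by gcongr
        _ = C ^ 2 * r := by ring
    have h2 : μ[q t] * μ[q u] * cov[q t, q u; μ] ≤ B * B * (C * r) := by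
      refine (le_abs_self _).trans ?_
      rw [abs_mul, abs_mul]
      gcongr
      · exact hmean t
      · exact hmean u
      · exact hcov' t u
    nlinarith
  rw [variance_fun_sum' fun t _ => memLp_sq_of_hasGaussianLaw (hq t), ← nsmul_eq_mul]
  refine Finset.sum_le_card_nsmul _ _ _ fun t _ => ?_
  have hK : 0 ≤ 2 * C ^ 2 + 4 * B ^ 2 * C := by positivity
  calc _ ≤ ∑ u ∈ I, (2 * C ^ 2 + 4 * B ^ 2 * C) * ρ ^ ((t - u) + (u - t)) :=
        Finset.sum_le_sum fun u _ => hterm t u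
    _ ≤ _ := by
        rw [← Finset.mul_sum]
        exact mul_le_mul_of_nonneg_left (sum_pow_dist_le hρ0.le hρ1 I t) hK

lemma variance_sub_le [IsProbabilityMeasure μ] {X Y : Ω → ℝ} (hX : MemLp X 2 μ)
    (hY : MemLp Y 2 μ) : Var[X - Y; μ] ≤ 2 * Var[X; μ] + 2 * Var[Y; μ] := by
  have h := variance_nonneg (X + Y) μ
  rw [variance_add hX hY] at h
  rw [variance_sub hX hY]
  linarith

lemma tendstoInMeasure_of_tendsto_integral_variance [IsProbabilityMeasure μ] {X : ℕ → Ω → ℝ}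
    {c : ℝ} (hX : ∀ n, MemLp (X n) 2 μ) (hmean : Tendsto (fun n => ∫ ω, X n ω ∂μ) atTop (𝓝 c))
    (hvar : Tendsto (fun n => Var[X n; μ]) atTop (𝓝 0)) :
    TendstoInMeasure μ X atTop (fun _ => c) := by
  have hsq : Tendsto (fun n => ∫ ω, (X n ω - c) ^ 2 ∂μ) atTop (𝓝 0) := by
    have h1 : ∀ n, ∫ ω, (X n ω - c) ^ 2 ∂μ = Var[X n; μ] + (∫ ω, X n ω ∂μ - c) ^ 2 := by
      intro n
      have hmem : MemLp (fun ω => X n ω - c) 2 μ := (hX n).sub (memLp_const c)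
      have h2 := variance_eq_sub hmem
      rw [variance_sub_const (hX n).aestronglyMeasurable] at h2
      have h3 : ∫ ω, (X n ω - c) ∂μ = ∫ ω, X n ω ∂μ - c := by
        rw [integral_sub ((hX n).integrable one_le_two) (integrable_const c)]; simp
      rw [h3] at h2
      rw [h2]
      simp
    simp only [h1]
    have h2 : Tendsto (fun n => ∫ ω, X n ω ∂μ - c) atTop (𝓝 0) := by
      simpa using hmean.sub_const c
    simpa using hvar.add (h2.pow 2)
  refine tendstoInMeasure_of_tendsto_eLpNorm (p := 2) (by norm_num)
    (fun n => (hX n).aestronglyMeasurable) aestronglyMeasurable_const ?_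
  have h3 : ∀ n, eLpNorm (X n - fun _ => c) 2 μ =
      ENNReal.ofReal ((∫ ω, (X n ω - c) ^ 2 ∂μ) ^ (2 : ℝ)⁻¹) := by
    intro n
    rw [((hX n).sub (memLp_const c)).eLpNorm_eq_integral_rpow_norm (by norm_num) (by norm_num)]
    simp
  simp only [h3]
  rw [← ENNReal.ofReal_zero]
  refine ENNReal.tendsto_ofReal ?_
  have := hsq.rpow_const (p := (2 : ℝ)⁻¹) (Or.inr (by norm_num))
  simpa using this

end SumsOfSquares

/-! ### Consistency of the sample covariance of a Gaussian sequence -/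

section SampleCovariance

variable {Ω : Type*} [MeasurableSpace Ω] {μ : Measure Ω}

lemma tendsto_average_Icc {u : ℕ → ℝ} {l : ℝ} (hu : Tendsto u atTop (𝓝 l)) (n₀ : ℕ) :
    Tendsto (fun n : ℕ => ((n : ℝ) - n₀ + 1)⁻¹ * ∑ t ∈ Finset.Icc n₀ n, u t) atTop (𝓝 l) := by
  have h1 : Tendsto (fun k => u (n₀ + k)) atTop (𝓝 l) :=
    hu.comp (tendsto_atTop_mono (fun k => Nat.le_add_left k n₀) tendsto_id)
  have h2 : Tendsto (fun n : ℕ => n + 1 - n₀) atTop atTop :=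
    (tendsto_sub_atTop_nat n₀).comp (tendsto_add_atTop_nat 1)
  refine (h1.cesaro.comp h2).congr' ?_
  filter_upwards [eventually_ge_atTop n₀] with n hn
  rw [Function.comp_apply, Nat.cast_sub (by omega), Nat.cast_add, Nat.cast_one,
    ← Finset.Ico_add_one_right_eq_Icc, Finset.sum_Ico_eq_sum_range]
  congr 2
  ring

omit [MeasurableSpace Ω] in
lemma sampleCov_apply {ι : Type*} (v : ℕ → Ω → ι → ℝ) (n₀ n : ℕ) (ω : Ω) (i j : ι) :
    sampleCov v n₀ n ω i j =
      ((n : ℝ) - n₀ + 1)⁻¹ * ∑ t ∈ Finset.Icc n₀ n, v t ω i * v t ω j := by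
  simp [sampleCov, Matrix.sum_apply, Matrix.vecMulVec_apply]

/-- For a jointly Gaussian sequence of random vectors whose autocovariances decay geometrically,
whose means tend to `0` and whose covariance matrices converge, the sample covariance is consistent.
Joint Gaussianity is encoded by a space of Gaussian variables that contains all components. -/
theorem sampleCov_consistent [IsProbabilityMeasure μ] {ι : Type*} {v : ℕ → Ω → ι → ℝ}
    {𝒢 : Submodule ℝ (Ω → ℝ)} (h𝒢 : ∀ f ∈ 𝒢, HasGaussianLaw f μ)
    (hv : ∀ t i, (fun ω => v t ω i) ∈ 𝒢) {C ρ : ℝ} (hρ0 : 0 < ρ) (hρ1 : ρ < 1)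
    (hcov : ∀ t k i j, |cov[fun ω => v (t + k) ω i, fun ω => v t ω j; μ]| ≤ C * ρ ^ k)
    (hmean : ∀ i, Tendsto (fun t => ∫ ω, v t ω i ∂μ) atTop (𝓝 0)) {V : Matrix ι ι ℝ}
    (hV : Tendsto (fun t => covMatrix μ (v t)) atTop (𝓝 V)) (n₀ : ℕ) (i j : ι) :
    (∀ n, MemLp (fun ω => sampleCov v n₀ n ω i j) 2 μ) ∧
      Tendsto (fun n => ∫ ω, sampleCov v n₀ n ω i j ∂μ) atTop (𝓝 (V i j)) ∧
      (fun n : ℕ => Var[fun ω => sampleCov v n₀ n ω i j; μ])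
        =O[atTop] (fun n : ℕ => 1 / (n : ℝ)) ∧
      TendstoInMeasure μ (fun n ω => sampleCov v n₀ n ω i j) atTop (fun _ => V i j) := by
  have hL2 : ∀ t i, MemLp (fun ω => v t ω i) 2 μ := fun t i => (h𝒢 _ (hv t i)).memLp_two
  -- Polarization: `v i * v j = ((v i + v j) ^ 2 - (v i - v j) ^ 2) / 4`.
  set p : ℕ → Ω → ℝ := fun t => (fun ω => v t ω i) + (fun ω => v t ω j) with hp
  set m : ℕ → Ω → ℝ := fun t => (fun ω => v t ω i) - (fun ω => v t ω j) with hm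
  have hp𝒢 : ∀ t, p t ∈ 𝒢 := fun t => 𝒢.add_mem (hv t i) (hv t j)
  have hm𝒢 : ∀ t, m t ∈ 𝒢 := fun t => 𝒢.sub_mem (hv t i) (hv t j)
  have hpol : ∀ t, (fun ω => v t ω i * v t ω j) =
      fun ω => 4⁻¹ * (p t ω ^ 2 - m t ω ^ 2) := by
    intro t; ext ω; simp only [hp, hm, Pi.add_apply, Pi.sub_apply]; ring
  have hprodL2 : ∀ t, MemLp (fun ω => v t ω i * v t ω j) 2 μ := by
    intro t
    rw [hpol]
    exact ((memLp_sq_of_hasGaussianLaw (h𝒢 _ (hp𝒢 t))).sub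
      (memLp_sq_of_hasGaussianLaw (h𝒢 _ (hm𝒢 t)))).const_mul _
  have hmem : ∀ n, MemLp (fun ω => sampleCov v n₀ n ω i j) 2 μ := by
    intro n
    simp only [sampleCov_apply]
    exact (memLp_finsetSum _ fun t _ => hprodL2 t).const_mul _
  have hexp : Tendsto (fun n => ∫ ω, sampleCov v n₀ n ω i j ∂μ) atTop (𝓝 (V i j)) := by
    have h1 : Tendsto (fun t => ∫ ω, v t ω i * v t ω j ∂μ) atTop (𝓝 (V i j)) := by
      have h2 : Tendsto (fun t => covMatrix μ (v t) i j) atTop (𝓝 (V i j)) :=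
        tendsto_pi_nhds.1 (tendsto_pi_nhds.1 hV i) j
      have h3 := h2.add ((hmean i).mul (hmean j))
      rw [mul_zero, add_zero] at h3
      refine h3.congr fun t => ?_
      simp only [covMatrix, Matrix.of_apply]
      rw [covariance_eq_sub (hL2 t i) (hL2 t j)]
      simp
    refine (tendsto_average_Icc h1 n₀).congr fun n => ?_
    simp only [sampleCov_apply]
    rw [integral_const_mul,
      integral_finsetSum _ fun t _ => (hprodL2 t).integrable one_le_two]
  obtain ⟨B, hB0, hB⟩ : ∃ B, 0 ≤ B ∧ ∀ t, |∫ ω, v t ω i ∂μ| ≤ B ∧ |∫ ω, v t ω j ∂μ| ≤ B := by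
    obtain ⟨b, hb⟩ := (hmean i).norm.bddAbove_range
    obtain ⟨c, hc⟩ := (hmean j).norm.bddAbove_range
    have hb' : ∀ t, |∫ ω, v t ω i ∂μ| ≤ b := fun t => hb ⟨t, rfl⟩
    have hc' : ∀ t, |∫ ω, v t ω j ∂μ| ≤ c := fun t => hc ⟨t, rfl⟩
    exact ⟨max b c, (abs_nonneg _).trans ((hb' 0).trans (le_max_left _ _)),
      fun t => ⟨(hb' t).trans (le_max_left _ _), (hc' t).trans (le_max_right _ _)⟩⟩
  have hpcov : ∀ t k, |cov[p (t + k), p t; μ]| ≤ (4 * C) * ρ ^ k := by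
    intro t k
    rw [hp, covariance_add_left (hL2 _ _) (hL2 _ _) ((hL2 _ _).add (hL2 _ _)),
      covariance_add_right (hL2 _ _) (hL2 _ _) (hL2 _ _),
      covariance_add_right (hL2 _ _) (hL2 _ _) (hL2 _ _)]
    have h1 := abs_le.1 (hcov t k i i)
    have h2 := abs_le.1 (hcov t k i j)
    have h3 := abs_le.1 (hcov t k j i)
    have h4 := abs_le.1 (hcov t k j j)
    exact abs_le.2 ⟨by linarith, by linarith⟩
  have hmcov : ∀ t k, |cov[m (t + k), m t; μ]| ≤ (4 * C) * ρ ^ k := by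
    intro t k
    rw [hm, covariance_sub_left (hL2 _ _) (hL2 _ _) ((hL2 _ _).sub (hL2 _ _)),
      covariance_sub_right (hL2 _ _) (hL2 _ _) (hL2 _ _),
      covariance_sub_right (hL2 _ _) (hL2 _ _) (hL2 _ _)]
    have h1 := abs_le.1 (hcov t k i i)
    have h2 := abs_le.1 (hcov t k i j)
    have h3 := abs_le.1 (hcov t k j i)
    have h4 := abs_le.1 (hcov t k j j)
    exact abs_le.2 ⟨by linarith, by linarith⟩
  have hint : ∀ t i, Integrable (fun ω => v t ω i) μ := fun t i =>
    (hL2 t i).integrable one_le_two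
  have hpmean : ∀ t, |μ[p t]| ≤ 2 * B := by
    intro t
    have h1 : μ[p t] = ∫ ω, v t ω i ∂μ + ∫ ω, v t ω j ∂μ := integral_add (hint t i) (hint t j)
    rw [h1]
    linarith [abs_add_le (∫ ω, v t ω i ∂μ) (∫ ω, v t ω j ∂μ), (hB t).1, (hB t).2]
  have hmmean : ∀ t, |μ[m t]| ≤ 2 * B := by
    intro t
    have h1 : μ[m t] = ∫ ω, v t ω i ∂μ - ∫ ω, v t ω j ∂μ := integral_sub (hint t i) (hint t j)
    rw [h1]
    linarith [abs_sub (∫ ω, v t ω i ∂μ) (∫ ω, v t ω j ∂μ), (hB t).1, (hB t).2]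
  set K : ℝ := (2 * (4 * C) ^ 2 + 4 * (2 * B) ^ 2 * (4 * C)) * (2 * (1 - ρ)⁻¹) with hK
  have hvarp : ∀ I : Finset ℕ, Var[fun ω => ∑ t ∈ I, p t ω ^ 2; μ] ≤ I.card * K :=
    variance_sum_sq_le (by positivity) hρ0 hρ1 (fun t => h𝒢 _ (hp𝒢 t))
      (fun t u => h𝒢 _ (𝒢.add_mem (hp𝒢 t) (hp𝒢 u)))
      (fun t u => h𝒢 _ (𝒢.sub_mem (hp𝒢 t) (hp𝒢 u))) hpcov hpmean
  have hvarm : ∀ I : Finset ℕ, Var[fun ω => ∑ t ∈ I, m t ω ^ 2; μ] ≤ I.card * K :=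
    variance_sum_sq_le (by positivity) hρ0 hρ1 (fun t => h𝒢 _ (hm𝒢 t))
      (fun t u => h𝒢 _ (𝒢.add_mem (hm𝒢 t) (hm𝒢 u)))
      (fun t u => h𝒢 _ (𝒢.sub_mem (hm𝒢 t) (hm𝒢 u))) hmcov hmmean
  have hvar : ∀ I : Finset ℕ, Var[fun ω => ∑ t ∈ I, v t ω i * v t ω j; μ] ≤ I.card * K := by
    intro I
    have h1 : (fun ω => ∑ t ∈ I, v t ω i * v t ω j) = fun ω => 4⁻¹ *
        ((fun ω => ∑ t ∈ I, p t ω ^ 2) - (fun ω => ∑ t ∈ I, m t ω ^ 2)) ω := by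
      ext ω
      rw [Pi.sub_apply, ← Finset.sum_sub_distrib, Finset.mul_sum]
      exact Finset.sum_congr rfl fun t _ => congrFun (hpol t) ω
    rw [h1, variance_const_mul]
    have h2 := variance_sub_le
      (memLp_finsetSum I fun t _ => memLp_sq_of_hasGaussianLaw (h𝒢 _ (hp𝒢 t)))
      (memLp_finsetSum I fun t _ => memLp_sq_of_hasGaussianLaw (h𝒢 _ (hm𝒢 t)))
    have h3 := hvarp I
    have h4 := hvarm I
    have h5 : 0 ≤ (I.card : ℝ) * K := (variance_nonneg _ _).trans h3
    linarith
  have hK0 : 0 ≤ K := by simpa using (variance_nonneg _ _).trans (hvar {0})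
  have hO : (fun n : ℕ => Var[fun ω => sampleCov v n₀ n ω i j; μ])
      =O[atTop] (fun n : ℕ => 1 / (n : ℝ)) := by
    refine IsBigO.of_bound (2 * K) ?_
    filter_upwards [eventually_ge_atTop (2 * n₀), eventually_ge_atTop 1] with n hn hn1
    have hcard : (((Finset.Icc n₀ n).card : ℕ) : ℝ) = (n : ℝ) - n₀ + 1 := by
      rw [Nat.card_Icc, Nat.cast_sub (by omega)]; push_cast; ring
    have hn' : (2 : ℝ) * n₀ ≤ n := by exact_mod_cast hn
    have hn1' : (1 : ℝ) ≤ n := by exact_mod_cast hn1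
    have hN : (n : ℝ) / 2 ≤ (n : ℝ) - n₀ + 1 := by linarith
    have hN0 : 0 < (n : ℝ) - n₀ + 1 := by linarith
    rw [Real.norm_of_nonneg (variance_nonneg _ _), Real.norm_of_nonneg (by positivity)]
    simp only [sampleCov_apply]
    rw [variance_const_mul]
    calc _ ≤ (((n : ℝ) - n₀ + 1)⁻¹) ^ 2 * (((n : ℝ) - n₀ + 1) * K) := by
          have h := hvar (Finset.Icc n₀ n)
          rw [hcard] at h
          gcongr
      _ = K * ((n : ℝ) - n₀ + 1)⁻¹ := by field_simp
      _ ≤ K * ((n : ℝ) / 2)⁻¹ := by gcongr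
      _ = 2 * K * (1 / n) := by field_simp
  refine ⟨hmem, hexp, hO, tendstoInMeasure_of_tendsto_integral_variance hmem hexp
    (hO.trans_tendsto tendsto_one_div_atTop_nhds_zero_nat)⟩

end SampleCovariance

/-! ### Cross-covariance matrices -/

section CrossCovariance

variable {Ω : Type*} [MeasurableSpace Ω] {μ : Measure Ω} {ι κ l : Type*}

/-- `Cov(X, Y)`, the cross-covariance matrix of two random vectors. -/
def crossCov (μ : Measure Ω) (X : Ω → ι → ℝ) (Y : Ω → κ → ℝ) : Matrix ι κ ℝ :=
  Matrix.of fun i j => cov[fun ω => X ω i, fun ω => Y ω j; μ]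

lemma crossCov_transpose (X : Ω → ι → ℝ) (Y : Ω → κ → ℝ) :
    (crossCov μ X Y)ᵀ = crossCov μ Y X := by
  ext i j
  simp [crossCov, covariance_comm]

lemma crossCov_add_left [IsProbabilityMeasure μ] {X X' : Ω → ι → ℝ} {Y : Ω → κ → ℝ}
    (hX : ∀ i, MemLp (fun ω => X ω i) 2 μ) (hX' : ∀ i, MemLp (fun ω => X' ω i) 2 μ)
    (hY : ∀ i, MemLp (fun ω => Y ω i) 2 μ) :
    crossCov μ (fun ω => X ω + X' ω) Y = crossCov μ X Y + crossCov μ X' Y := by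
  ext i j
  exact covariance_add_left (hX i) (hX' i) (hY j)

lemma crossCov_mulVec_left [IsProbabilityMeasure μ] [Fintype ι] {X : Ω → ι → ℝ} {Y : Ω → κ → ℝ}
    (A : Matrix l ι ℝ) (hX : ∀ i, MemLp (fun ω => X ω i) 2 μ)
    (hY : ∀ i, MemLp (fun ω => Y ω i) 2 μ) :
    crossCov μ (fun ω => A *ᵥ X ω) Y = A * crossCov μ X Y := by
  ext i j
  rw [Matrix.mul_apply]
  simp only [crossCov, Matrix.of_apply, Matrix.mulVec, dotProduct]
  rw [covariance_fun_sum_left (fun k => (hX k).const_mul (A i k)) (hY j)]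
  simp only [covariance_const_mul_left]

lemma memLp_mulVec [Fintype ι] {X : Ω → ι → ℝ} (A : Matrix l ι ℝ)
    (hX : ∀ i, MemLp (fun ω => X ω i) 2 μ) (i : l) :
    MemLp (fun ω => (A *ᵥ X ω) i) 2 μ := by
  simp only [Matrix.mulVec, dotProduct]
  exact memLp_finsetSum _ fun k _ => (hX k).const_mul (A i k)

lemma integral_mulVec [IsFiniteMeasure μ] [Fintype ι] {X : Ω → ι → ℝ} (A : Matrix l ι ℝ)
    (hX : ∀ i, MemLp (fun ω => X ω i) 2 μ) (i : l) :
    ∫ ω, (A *ᵥ X ω) i ∂μ = (A *ᵥ fun k => ∫ ω, X ω k ∂μ) i := by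
  simp only [Matrix.mulVec, dotProduct]
  rw [integral_finsetSum _ fun k _ => ((hX k).const_mul (A i k)).integrable one_le_two]
  simp only [integral_const_mul]

lemma integral_mulVec_add [IsFiniteMeasure μ] [Fintype ι] {X : Ω → ι → ℝ} {E : Ω → l → ℝ}
    (A : Matrix l ι ℝ) (hX : ∀ i, MemLp (fun ω => X ω i) 2 μ)
    (hE : ∀ i, MemLp (fun ω => E ω i) 2 μ) (hE0 : ∀ i, ∫ ω, E ω i ∂μ = 0) (i : l) :
    ∫ ω, (A *ᵥ X ω + E ω) i ∂μ = (A *ᵥ fun k => ∫ ω, X ω k ∂μ) i := by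
  simp only [Pi.add_apply]
  rw [integral_add ((memLp_mulVec A hX i).integrable one_le_two)
    ((hE i).integrable one_le_two), hE0, add_zero, integral_mulVec A hX]

lemma crossCov_mulVec_add_left [IsProbabilityMeasure μ] [Fintype ι] {X : Ω → ι → ℝ}
    {Y : Ω → κ → ℝ} {E : Ω → l → ℝ} (A : Matrix l ι ℝ) (hX : ∀ i, MemLp (fun ω => X ω i) 2 μ)
    (hE : ∀ i, MemLp (fun ω => E ω i) 2 μ) (hY : ∀ i, MemLp (fun ω => Y ω i) 2 μ) :
    crossCov μ (fun ω => A *ᵥ X ω + E ω) Y = A * crossCov μ X Y + crossCov μ E Y := by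
  rw [crossCov_add_left (memLp_mulVec A hX) hE hY, crossCov_mulVec_left A hX hY]

lemma crossCov_mulVec_add_right [IsProbabilityMeasure μ] [Fintype ι] {X : Ω → ι → ℝ}
    {Y : Ω → κ → ℝ} {E : Ω → l → ℝ} (A : Matrix l ι ℝ) (hX : ∀ i, MemLp (fun ω => X ω i) 2 μ)
    (hE : ∀ i, MemLp (fun ω => E ω i) 2 μ) (hY : ∀ i, MemLp (fun ω => Y ω i) 2 μ) :
    crossCov μ Y (fun ω => A *ᵥ X ω + E ω) = crossCov μ Y X * Aᵀ + crossCov μ Y E := by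
  rw [← crossCov_transpose, crossCov_mulVec_add_left A hX hE hY, Matrix.transpose_add,
    Matrix.transpose_mul, crossCov_transpose, crossCov_transpose]

end CrossCovariance

/-! ### Second-order theory of linear state-space recursions -/

section StateSpace

variable {Ω m s : Type*} [MeasurableSpace Ω] {μ : Measure Ω} [Fintype m] [Fintype s]
  [DecidableEq s]

/-- A linear recursion `x (t + 1) = A t x t + w t` observed with the noise `ε t`. The pairs
`(w t, ε t)` have mean zero, are uncorrelated over time and with `x 0`, and have covariances
`Cov(w t, w t) = W t`, `Cov(ε t, ε t) = Se` and `Cov(w t, ε t) = N t`. The last one need not vanish,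
since the observation noise enters the prediction error of a filter. -/
structure IsStateSpace (μ : Measure Ω) (A W : ℕ → Matrix s s ℝ) (N : ℕ → Matrix s m ℝ)
    (Se : Matrix m m ℝ) (x w : ℕ → Ω → s → ℝ) (ε : ℕ → Ω → m → ℝ) : Prop where
  step : ∀ t ω, x (t + 1) ω = A t *ᵥ x t ω + w t ω
  memLp_init : ∀ i, MemLp (fun ω => x 0 ω i) 2 μ
  memLp_w : ∀ t i, MemLp (fun ω => w t ω i) 2 μ
  memLp_eps : ∀ t i, MemLp (fun ω => ε t ω i) 2 μ
  mean_w : ∀ t i, ∫ ω, w t ω i ∂μ = 0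
  mean_eps : ∀ t i, ∫ ω, ε t ω i ∂μ = 0
  init_w : ∀ t, crossCov μ (x 0) (w t) = 0
  init_eps : ∀ t, crossCov μ (x 0) (ε t) = 0
  w_w : ∀ t, crossCov μ (w t) (w t) = W t
  w_w_ne : ∀ t u, t ≠ u → crossCov μ (w t) (w u) = 0
  eps_eps : ∀ t, crossCov μ (ε t) (ε t) = Se
  eps_eps_ne : ∀ t u, t ≠ u → crossCov μ (ε t) (ε u) = 0
  w_eps : ∀ t, crossCov μ (w t) (ε t) = N t
  w_eps_ne : ∀ t u, t ≠ u → crossCov μ (w t) (ε u) = 0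

namespace IsStateSpace

variable {A W : ℕ → Matrix s s ℝ} {N : ℕ → Matrix s m ℝ} {Se : Matrix m m ℝ}
  {x w : ℕ → Ω → s → ℝ} {ε : ℕ → Ω → m → ℝ} (h : IsStateSpace μ A W N Se x w ε)

include h

omit [Fintype m] [DecidableEq s] in
lemma memLp_state (t : ℕ) (i : s) : MemLp (fun ω => x t ω i) 2 μ := by
  induction t generalizing i with
  | zero => exact h.memLp_init i
  | succ t ih =>
    simp only [h.step]
    exact (memLp_mulVec (A t) ih i).add (h.memLp_w t i)

variable [IsProbabilityMeasure μ]

omit [Fintype m] [DecidableEq s] in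
lemma crossCov_succ_left {κ : Type*} {Y : Ω → κ → ℝ} (hY : ∀ i, MemLp (fun ω => Y ω i) 2 μ)
    (t : ℕ) : crossCov μ (x (t + 1)) Y = A t * crossCov μ (x t) Y + crossCov μ (w t) Y := by
  rw [show x (t + 1) = fun ω => A t *ᵥ x t ω + w t ω from funext (h.step t)]
  exact crossCov_mulVec_add_left _ (h.memLp_state t) (h.memLp_w t) hY

omit [Fintype m] [DecidableEq s] in
lemma crossCov_state_w {t u : ℕ} (htu : t ≤ u) : crossCov μ (x t) (w u) = 0 := by
  induction t with
  | zero => exact h.init_w u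
  | succ t ih =>
    rw [h.crossCov_succ_left (h.memLp_w u), ih (by omega), h.w_w_ne t u (by omega)]
    simp

omit [Fintype m] [DecidableEq s] in
lemma crossCov_state_eps {t u : ℕ} (htu : t ≤ u) : crossCov μ (x t) (ε u) = 0 := by
  induction t with
  | zero => exact h.init_eps u
  | succ t ih =>
    rw [h.crossCov_succ_left (h.memLp_eps u), ih (by omega), h.w_eps_ne t u (by omega)]
    simp

omit [Fintype m] [DecidableEq s] in
lemma crossCov_state_succ (t : ℕ) : crossCov μ (x (t + 1)) (x (t + 1)) =
    A t * crossCov μ (x t) (x t) * (A t)ᵀ + W t := by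
  have h1 : crossCov μ (x (t + 1)) (w t) = W t := by
    rw [h.crossCov_succ_left (h.memLp_w t), h.crossCov_state_w le_rfl, h.w_w, Matrix.mul_zero,
      zero_add]
  have h2 : crossCov μ (x (t + 1)) (x t) = A t * crossCov μ (x t) (x t) := by
    rw [h.crossCov_succ_left (h.memLp_state t), ← crossCov_transpose (x t) (w t),
      h.crossCov_state_w le_rfl, Matrix.transpose_zero, add_zero]
  conv_lhs => arg 3; rw [show x (t + 1) = fun ω => A t *ᵥ x t ω + w t ω from funext (h.step t)]
  rw [crossCov_mulVec_add_right _ (h.memLp_state t) (h.memLp_w t) (h.memLp_state (t + 1)), h1, h2]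

omit [Fintype m] in
lemma crossCov_state_add {κ : Type*} {Y : Ω → κ → ℝ} (hY : ∀ i, MemLp (fun ω => Y ω i) 2 μ)
    {t : ℕ} (hwY : ∀ u, t ≤ u → crossCov μ (w u) Y = 0) (k : ℕ) :
    crossCov μ (x (t + k)) Y = transition A t k * crossCov μ (x t) Y := by
  induction k with
  | zero => simp [transition]
  | succ k ih =>
    rw [← add_assoc, h.crossCov_succ_left hY, ih, hwY _ (by omega), add_zero, transition,
      Matrix.mul_assoc]

omit [Fintype m] in
lemma crossCov_state_state (t k : ℕ) :
    crossCov μ (x (t + k)) (x t) = transition A t k * crossCov μ (x t) (x t) :=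
  h.crossCov_state_add (h.memLp_state t) (fun u hu => by
    rw [← crossCov_transpose, h.crossCov_state_w hu, Matrix.transpose_zero]) k

omit [Fintype m] in
lemma crossCov_state_add_eps (t k : ℕ) :
    crossCov μ (x (t + 1 + k)) (ε t) = transition A (t + 1) k * N t := by
  rw [h.crossCov_state_add (h.memLp_eps t) (fun u hu => h.w_eps_ne u t (by omega)) k,
    h.crossCov_succ_left (h.memLp_eps t), h.crossCov_state_eps le_rfl, h.w_eps, Matrix.mul_zero,
    zero_add]

omit [Fintype m] in
lemma crossCov_obs (Z : Matrix m s ℝ) (t k : ℕ) :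
    crossCov μ (fun ω => Z *ᵥ x (t + k) ω + ε (t + k) ω) (fun ω => Z *ᵥ x t ω + ε t ω) =
      Z * (transition A t k * crossCov μ (x t) (x t)) * Zᵀ + Z * crossCov μ (x (t + k)) (ε t) +
        crossCov μ (ε (t + k)) (ε t) := by
  have h1 : crossCov μ (ε (t + k)) (x t) = 0 := by
    rw [← crossCov_transpose, h.crossCov_state_eps (by omega), Matrix.transpose_zero]
  have hv : ∀ i, MemLp (fun ω => (Z *ᵥ x t ω + ε t ω) i) 2 μ := fun i =>
    (memLp_mulVec Z (h.memLp_state t) i).add (h.memLp_eps t i)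
  rw [crossCov_mulVec_add_left Z (h.memLp_state _) (h.memLp_eps _) hv,
    crossCov_mulVec_add_right Z (h.memLp_state t) (h.memLp_eps t) (h.memLp_state _),
    crossCov_mulVec_add_right Z (h.memLp_state t) (h.memLp_eps t) (h.memLp_eps _),
    h1, h.crossCov_state_state, Matrix.mul_add, Matrix.zero_mul, zero_add, ← Matrix.mul_assoc Z]

omit [Fintype m] in
lemma integral_state (t : ℕ) :
    (fun i => ∫ ω, x t ω i ∂μ) = transition A 0 t *ᵥ fun i => ∫ ω, x 0 ω i ∂μ := by
  induction t with
  | zero => simp [transition]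
  | succ t ih =>
    rw [transition, zero_add, ← Matrix.mulVec_mulVec, ← ih]
    ext i
    simp only [h.step]
    exact integral_mulVec_add _ (h.memLp_state t) (h.memLp_w t) (h.mean_w t) i

omit [Fintype m] in
lemma integral_obs (Z : Matrix m s ℝ) (t : ℕ) :
    (fun i => ∫ ω, (Z *ᵥ x t ω + ε t ω) i ∂μ) =
      Z *ᵥ (transition A 0 t *ᵥ fun i => ∫ ω, x 0 ω i ∂μ) := by
  rw [← h.integral_state]
  ext i
  exact integral_mulVec_add _ (h.memLp_state t) (h.memLp_eps t) (h.mean_eps t) i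

end IsStateSpace

open scoped Matrix.Norms.Frobenius

omit [DecidableEq s] in
lemma abs_apply_le_frobenius (B : Matrix m s ℝ) (i : m) (j : s) : |B i j| ≤ ‖B‖ := by
  rw [Matrix.frobenius_norm_def, ← Real.sqrt_eq_rpow]
  refine Real.abs_le_sqrt ?_
  simp only [Real.rpow_two, Real.norm_eq_abs, sq_abs]
  exact (Finset.single_le_sum (f := fun j => B i j ^ 2) (fun _ _ => sq_nonneg _)
    (Finset.mem_univ j)).trans (Finset.single_le_sum (f := fun i => ∑ j, B i j ^ 2)
      (fun _ _ => Finset.sum_nonneg fun _ _ => sq_nonneg _) (Finset.mem_univ i))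

/-- If the coefficients converge and the limit of `A` is stable, then the observations
`Z x t + ε t` have convergent covariance matrices, geometrically decaying autocovariances and means
tending to `0`. -/
theorem IsStateSpace.exists_stationary_limit [IsProbabilityMeasure μ] {A W : ℕ → Matrix s s ℝ}
    {N : ℕ → Matrix s m ℝ} {Se : Matrix m m ℝ} {x w : ℕ → Ω → s → ℝ} {ε : ℕ → Ω → m → ℝ}
    (h : IsStateSpace μ A W N Se x w ε) {A₀ W₀ : Matrix s s ℝ} {N₀ : Matrix s m ℝ}
    (hA : Tendsto A atTop (𝓝 A₀)) (hpow : Tendsto (fun k => A₀ ^ k) atTop (𝓝 0))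
    (hW : Tendsto W atTop (𝓝 W₀)) (hN : Tendsto N atTop (𝓝 N₀)) (Z : Matrix m s ℝ) :
    ∃ (V : Matrix m m ℝ) (C ρ : ℝ), 0 < ρ ∧ ρ < 1 ∧
      Tendsto (fun t => covMatrix μ fun ω => Z *ᵥ x t ω + ε t ω) atTop (𝓝 V) ∧
      (∀ t k i j, |cov[fun ω => (Z *ᵥ x (t + k) ω + ε (t + k) ω) i,
        fun ω => (Z *ᵥ x t ω + ε t ω) j; μ]| ≤ C * ρ ^ k) ∧
      ∀ i, Tendsto (fun t => ∫ ω, (Z *ᵥ x t ω + ε t ω) i ∂μ) atTop (𝓝 0) := by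
  obtain ⟨C, ρ, hC, hρ0, hρ1, hbound⟩ := exists_norm_transition_le_geometric hA hpow
  obtain ⟨S₀, hS⟩ := exists_tendsto_of_lyapunov_recursion (S := fun t => crossCov μ (x t) (x t))
    hA hpow hW h.crossCov_state_succ
  obtain ⟨b, hb⟩ := hS.norm.bddAbove_range
  obtain ⟨c, hc⟩ := hN.norm.bddAbove_range
  have hb' : ∀ t, ‖crossCov μ (x t) (x t)‖ ≤ b := fun t => hb ⟨t, rfl⟩
  have hc' : ∀ t, ‖N t‖ ≤ c := fun t => hc ⟨t, rfl⟩
  have hb0 : 0 ≤ b := (norm_nonneg _).trans (hb' 0)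
  have hc0 : 0 ≤ c := (norm_nonneg _).trans (hc' 0)
  have hstate : ∀ t k, ‖Z * (transition A t k * crossCov μ (x t) (x t)) * Zᵀ‖ ≤
      ‖Z‖ * (C * b) * ‖Z‖ * ρ ^ k := by
    intro t k
    calc _ ≤ ‖Z‖ * (‖transition A t k‖ * ‖crossCov μ (x t) (x t)‖) * ‖Zᵀ‖ := by
          refine (Matrix.frobenius_norm_mul _ _).trans
            (mul_le_mul_of_nonneg_right ?_ (norm_nonneg _))
          exact (Matrix.frobenius_norm_mul _ _).trans
            (mul_le_mul_of_nonneg_left (norm_mul_le _ _) (norm_nonneg _))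
      _ ≤ ‖Z‖ * ((C * ρ ^ k) * b) * ‖Z‖ := by
          rw [Matrix.frobenius_norm_transpose]
          gcongr
          · exact hbound t k
          · exact hb' t
      _ = _ := by ring
  refine ⟨Z * S₀ * Zᵀ + Se, ‖Z‖ * (C * b) * ‖Z‖ + ‖Z‖ * (C * c) * ρ⁻¹ + ‖Se‖, ρ, hρ0, hρ1,
    ?_, fun t k i j => ?_, fun i => ?_⟩
  · refine ((tendsto_matrix_mul (tendsto_matrix_mul tendsto_const_nhds hS)
      tendsto_const_nhds).add_const Se).congr fun t => ?_
    have h1 := h.crossCov_obs Z t 0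
    rw [add_zero, h.crossCov_state_eps le_rfl, h.eps_eps, Matrix.mul_zero, add_zero, transition,
      Matrix.one_mul] at h1
    exact h1.symm
  · refine (abs_apply_le_frobenius (crossCov μ (fun ω => Z *ᵥ x (t + k) ω + ε (t + k) ω)
      fun ω => Z *ᵥ x t ω + ε t ω) i j).trans ?_
    rw [h.crossCov_obs]
    have hρk : 0 ≤ ρ ^ k := by positivity
    have e1 := hstate t k
    have e2 : ‖Z * crossCov μ (x (t + k)) (ε t)‖ ≤ ‖Z‖ * (C * c) * ρ⁻¹ * ρ ^ k := by
      rcases k with _ | k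
      · rw [add_zero, h.crossCov_state_eps le_rfl, Matrix.mul_zero, norm_zero]
        positivity
      · rw [show t + (k + 1) = t + 1 + k by omega, h.crossCov_state_add_eps]
        calc _ ≤ ‖Z‖ * (‖transition A (t + 1) k‖ * ‖N t‖) :=
              (Matrix.frobenius_norm_mul _ _).trans
                (mul_le_mul_of_nonneg_left (Matrix.frobenius_norm_mul _ _) (norm_nonneg _))
          _ ≤ ‖Z‖ * ((C * ρ ^ k) * c) := by
              gcongr
              · exact hbound _ k
              · exact hc' t
          _ = _ := by rw [pow_succ]; field_simp
    have e3 : ‖crossCov μ (ε (t + k)) (ε t)‖ ≤ ‖Se‖ * ρ ^ k := by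
      rcases k with _ | k
      · rw [add_zero, h.eps_eps, pow_zero, mul_one]
      · rw [h.eps_eps_ne _ _ (by omega), norm_zero]
        positivity
    refine (norm_add_le _ _).trans ?_
    have e4 := norm_add_le (Z * (transition A t k * crossCov μ (x t) (x t)) * Zᵀ)
      (Z * crossCov μ (x (t + k)) (ε t))
    linarith
  · have h1 : Tendsto (fun t => transition A 0 t) atTop (𝓝 0) := by
      refine squeeze_zero_norm (fun t => hbound 0 t) ?_
      simpa using (tendsto_pow_atTop_nhds_zero_of_lt_one hρ0.le hρ1).const_mul C
    have hcont : Continuous fun Φ : Matrix s s ℝ => Z *ᵥ (Φ *ᵥ fun i => ∫ ω, x 0 ω i ∂μ) :=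
      continuous_const.matrix_mulVec (continuous_id.matrix_mulVec continuous_const)
    have h2 := tendsto_pi_nhds.1 ((hcont.tendsto 0).comp h1) i
    simp only [Matrix.zero_mulVec, Matrix.mulVec_zero, Pi.zero_apply] at h2
    exact h2.congr fun t => (congrFun (h.integral_obs Z t) i).symm

end StateSpace

/-! ### The prediction error of the misspecified filter -/

namespace Model

variable {d : ℕ} {p : Fin d → ℕ} (M : Model d p)

/-- `K'_t`, the gain of the filter that disregards the correlation between the series. -/
def gain' (P0' : ∀ j, Matrix (Fin (p j)) (Fin (p j)) ℝ) (t : ℕ) :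
    Matrix (StateIdx p) (Fin d) ℝ :=
  kalmanK M.Z M.covEps' (M.P' P0' t)

variable {Ω : Type*}

/-- `α_t - a'_t`, the error of the state prediction by the filter that disregards the correlation
between the series. -/
def predError (a0' : StateIdx p → ℝ) (P0' : ∀ j, Matrix (Fin (p j)) (Fin (p j)) ℝ)
    (α0 : Ω → StateIdx p → ℝ) (ε : ℕ → Ω → Fin d → ℝ) (η : ℕ → Ω → StateIdx p → ℝ)
    (t : ℕ) (ω : Ω) : StateIdx p → ℝ :=
  M.state α0 η t ω -
    kalmanA M.Z M.T M.covEps' M.covEta' (Matrix.blockDiagonal' P0') a0'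
      (fun u => M.obs α0 ε η u ω) t

/-- `η_t - T K'_t ε_t`, the noise that enters the prediction error at time `t`. -/
def predNoise (P0' : ∀ j, Matrix (Fin (p j)) (Fin (p j)) ℝ) (ε : ℕ → Ω → Fin d → ℝ)
    (η : ℕ → Ω → StateIdx p → ℝ) (t : ℕ) (ω : Ω) : StateIdx p → ℝ :=
  (-(M.T * M.gain' P0' t)) *ᵥ ε t ω + η t ω

variable {M} {a0' : StateIdx p → ℝ} {P0' : ∀ j, Matrix (Fin (p j)) (Fin (p j)) ℝ}
  {α0 : Ω → StateIdx p → ℝ} {ε : ℕ → Ω → Fin d → ℝ} {η : ℕ → Ω → StateIdx p → ℝ}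

lemma v'_eq (t : ℕ) : M.v' a0' P0' α0 ε η t =
    fun ω => M.Z *ᵥ M.predError a0' P0' α0 ε η t ω + ε t ω := by
  ext1 ω
  rw [v', predError, obs, Matrix.mulVec_sub]
  abel

/-- The prediction error follows a linear recursion with the closed-loop matrix `T L'_t`.
The observations enter only through the prediction error and the noise `ε_t`. -/
lemma predError_succ (t : ℕ) (ω : Ω) : M.predError a0' P0' α0 ε η (t + 1) ω =
    (M.T * M.L' P0' t) *ᵥ M.predError a0' P0' α0 ε η t ω + M.predNoise P0' ε η t ω := by
  rw [predNoise, predError, state, kalmanA, L', kalmanL]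
  have h : M.obs α0 ε η t ω - M.Z *ᵥ kalmanA M.Z M.T M.covEps' M.covEta'
      (Matrix.blockDiagonal' P0') a0' (fun u => M.obs α0 ε η u ω) t =
      M.Z *ᵥ M.predError a0' P0' α0 ε η t ω + ε t ω := congrFun (v'_eq t) ω
  rw [h]
  simp only [gain', P', Matrix.mul_sub, Matrix.mul_one, Matrix.sub_mulVec, Matrix.mulVec_add,
    Matrix.neg_mulVec, ← Matrix.mulVec_mulVec]
  rw [predError]
  simp only [Matrix.mulVec_sub]
  abel

lemma posSemidef_blockDiagonal' (hP0' : ∀ j, (P0' j).PosSemidef) :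
    (Matrix.blockDiagonal' P0').PosSemidef := by
  refine Matrix.PosSemidef.of_dotProduct_mulVec_nonneg ?_ fun x => ?_
  · rw [Matrix.IsHermitian, Matrix.blockDiagonal'_conjTranspose]
    congr 1
    ext1 j
    exact (hP0' j).isHermitian
  · have h : star x ⬝ᵥ Matrix.blockDiagonal' P0' *ᵥ x =
        ∑ j, star (fun k => x ⟨j, k⟩) ⬝ᵥ P0' j *ᵥ (fun k => x ⟨j, k⟩) := by
      simp only [dotProduct, Matrix.mulVec, Fintype.sum_sigma]
      refine Finset.sum_congr rfl fun j _ => Finset.sum_congr rfl fun k _ => ?_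
      congr 1
      rw [Finset.sum_eq_single j]
      · simp [Matrix.blockDiagonal'_apply_eq]
      · intro j' _ hj'
        exact Finset.sum_eq_zero fun k' _ => by
          rw [Matrix.blockDiagonal'_apply_ne _ _ _ hj'.symm, zero_mul]
      · simp
    rw [h]
    exact Finset.sum_nonneg fun j _ => (hP0' j).dotProduct_mulVec_nonneg _

open scoped Matrix.Norms.Frobenius in
lemma Assumptions.exists_norm_transition_le (hM : M.Assumptions P0') :
    ∃ C : ℝ, ∀ k, ‖transition (fun t => M.T * M.L' P0' t) 0 k‖ ≤ C := by
  obtain ⟨C, -, hC⟩ := hM.bounded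
  refine ⟨max ‖(1 : Matrix (StateIdx p) (StateIdx p) ℝ)‖ C, fun k => ?_⟩
  rcases k with _ | k
  · exact le_max_left _ _
  · refine le_trans ?_ (le_max_right _ _)
    have h := hC 0 k k (Nat.zero_le k) le_rfl
    rw [transition_eq_list_prod, Matrix.frobenius_norm_def, ← Real.sqrt_eq_rpow]
    simpa [frobNorm] using h

section Probability

variable [MeasurableSpace Ω] {μ : Measure Ω}

lemma IsInput.memLp_init (hin : M.IsInput μ α0 ε η) (k : StateIdx p) :
    MemLp (fun ω => α0 ω k) 2 μ :=
  (hin.gaussian.hasGaussianLaw_eval (Sum.inl k)).memLp_two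

lemma IsInput.memLp_eps (hin : M.IsInput μ α0 ε η) (t : ℕ) (i : Fin d) :
    MemLp (fun ω => ε t ω i) 2 μ :=
  (hin.gaussian.hasGaussianLaw_eval (Sum.inr (Sum.inl (t, i)))).memLp_two

lemma IsInput.memLp_eta (hin : M.IsInput μ α0 ε η) (t : ℕ) (k : StateIdx p) :
    MemLp (fun ω => η t ω k) 2 μ :=
  (hin.gaussian.hasGaussianLaw_eval (Sum.inr (Sum.inr (t, k)))).memLp_two

lemma IsInput.isStateSpace [IsProbabilityMeasure μ] (hin : M.IsInput μ α0 ε η) :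
    IsStateSpace μ (fun t => M.T * M.L' P0' t)
      (fun t => (M.T * M.gain' P0' t) * M.covEps * (M.T * M.gain' P0' t)ᵀ + M.covEta)
      (fun t => -(M.T * M.gain' P0' t * M.covEps)) M.covEps
      (M.predError a0' P0' α0 ε η) (M.predNoise P0' ε η) ε := by
  have he := hin.memLp_eps
  have hn := hin.memLp_eta
  have hw : ∀ t i, MemLp (fun ω => M.predNoise P0' ε η t ω i) 2 μ := fun t i =>
    (memLp_mulVec _ (he t) i).add (hn t i)
  have eps_eps : ∀ t, crossCov μ (ε t) (ε t) = M.covEps := hin.cov_eps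
  have eta_eta : ∀ t, crossCov μ (η t) (η t) = M.covEta := hin.cov_eta
  have eps_ne : ∀ t u, t ≠ u → crossCov μ (ε t) (ε u) = 0 := fun t u htu => by
    ext i j; exact hin.uncorr_eps t u htu i j
  have eta_ne : ∀ t u, t ≠ u → crossCov μ (η t) (η u) = 0 := fun t u htu => by
    ext i j; exact hin.uncorr_eta t u htu i j
  have eps_eta : ∀ t u, crossCov μ (ε t) (η u) = 0 := fun t u => by
    ext i j; exact hin.uncorr_eps_eta t u i j
  have eta_eps : ∀ t u, crossCov μ (η t) (ε u) = 0 := fun t u => by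
    rw [← crossCov_transpose, eps_eta, Matrix.transpose_zero]
  have w_eps : ∀ t u, crossCov μ (M.predNoise P0' ε η t) (ε u) =
      -(M.T * M.gain' P0' t) * crossCov μ (ε t) (ε u) := fun t u => by
    have h := crossCov_mulVec_add_left (-(M.T * M.gain' P0' t)) (he t) (hn t) (he u)
    rwa [eta_eps, add_zero] at h
  have w_eta : ∀ t u, crossCov μ (M.predNoise P0' ε η t) (η u) = crossCov μ (η t) (η u) :=
    fun t u => by
      have h := crossCov_mulVec_add_left (-(M.T * M.gain' P0' t)) (he t) (hn t) (hn u)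
      rwa [eps_eta, Matrix.mul_zero, zero_add] at h
  have w_w : ∀ t u, crossCov μ (M.predNoise P0' ε η t) (M.predNoise P0' ε η u) =
      -(M.T * M.gain' P0' t) * crossCov μ (ε t) (ε u) * (-(M.T * M.gain' P0' u))ᵀ +
        crossCov μ (η t) (η u) := fun t u => by
    have h := crossCov_mulVec_add_right (-(M.T * M.gain' P0' u)) (he u) (hn u) (hw t)
    rwa [w_eps, w_eta] at h
  have init : ∀ {κ : Type} (Y : Ω → κ → ℝ), crossCov μ (M.predError a0' P0' α0 ε η 0) Y =
      crossCov μ α0 Y := fun Y => by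
    ext i j
    exact covariance_sub_const_left ((hin.memLp_init i).integrable one_le_two) (a0' i)
  have init_eps : ∀ t, crossCov μ α0 (ε t) = 0 := fun t => by
    ext i j; exact hin.uncorr_init_eps t i j
  have init_eta : ∀ t, crossCov μ α0 (η t) = 0 := fun t => by
    ext i j; exact hin.uncorr_init_eta t i j
  exact
  { step := predError_succ
    memLp_init := fun i => (hin.memLp_init i).sub (memLp_const (a0' i))
    memLp_w := hw
    memLp_eps := he
    mean_w := fun t i =>
      (integral_mulVec_add _ (he t) (hn t) (hin.mean_eta t) i).trans (by
        simp [hin.mean_eps, Matrix.mulVec, dotProduct])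
    mean_eps := hin.mean_eps
    init_w := fun t => by
      rw [init]
      have h := crossCov_mulVec_add_right (-(M.T * M.gain' P0' t)) (he t) (hn t) hin.memLp_init
      rwa [init_eps, init_eta, Matrix.zero_mul, add_zero] at h
    init_eps := fun t => by rw [init, init_eps]
    w_w := fun t => by
      rw [w_w, eps_eps, eta_eta]
      simp
    w_w_ne := fun t u htu => by rw [w_w, eps_ne t u htu, eta_ne t u htu]; simp
    eps_eps := eps_eps
    eps_eps_ne := eps_ne
    w_eps := fun t => by rw [w_eps, eps_eps, Matrix.neg_mul]
    w_eps_ne := fun t u htu => by rw [w_eps, eps_ne t u htu, Matrix.mul_zero] }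

omit [MeasurableSpace Ω] in
lemma mulVec_add_mem {ι κ : Type*} [Fintype ι] {𝒢 : Submodule ℝ (Ω → ℝ)} {X : Ω → ι → ℝ}
    {Y : Ω → κ → ℝ} (A : Matrix κ ι ℝ) (hX : ∀ i, (fun ω => X ω i) ∈ 𝒢)
    (hY : ∀ i, (fun ω => Y ω i) ∈ 𝒢) (i : κ) : (fun ω => (A *ᵥ X ω + Y ω) i) ∈ 𝒢 := by
  have h : (fun ω => (A *ᵥ X ω + Y ω) i) =
      ∑ k, A i k • (fun ω => X ω k) + fun ω => Y ω i := by
    ext ω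
    simp [Matrix.mulVec, dotProduct]
  rw [h]
  exact 𝒢.add_mem (𝒢.sum_mem fun k _ => 𝒢.smul_mem _ (hX k)) (hY i)

/-- The components of all `v'_t` are affine combinations of the Gaussian inputs. -/
lemma IsInput.exists_gaussian_submodule (hin : M.IsInput μ α0 ε η) :
    ∃ 𝒢 : Submodule ℝ (Ω → ℝ), (∀ f ∈ 𝒢, HasGaussianLaw f μ) ∧
      ∀ t i, (fun ω => M.v' a0' P0' α0 ε η t ω i) ∈ 𝒢 := by
  refine ⟨_, fun f hf => hasGaussianLaw_of_mem_span hin.gaussian hf, ?_⟩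
  set 𝒢 := Submodule.span ℝ (insert (fun _ : Ω => (1 : ℝ)) (Set.range
    (Sum.elim (fun k ω => α0 ω k) (Sum.elim (fun (ti : ℕ × Fin d) ω => ε ti.1 ω ti.2)
      (fun (tk : ℕ × StateIdx p) ω => η tk.1 ω tk.2)) :
      StateIdx p ⊕ (ℕ × Fin d) ⊕ (ℕ × StateIdx p) → Ω → ℝ)))
  have hconst : ∀ c : ℝ, (fun _ : Ω => c) ∈ 𝒢 := fun c => by
    have h := 𝒢.smul_mem c (Submodule.subset_span (Set.mem_insert (fun _ : Ω => (1 : ℝ)) _))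
    have h2 : (c • fun _ : Ω => (1 : ℝ)) = fun _ => c := by ext; simp
    rwa [h2] at h
  have hinit : ∀ k, (fun ω => α0 ω k) ∈ 𝒢 := fun k =>
    Submodule.subset_span (Set.mem_insert_of_mem _ ⟨Sum.inl k, rfl⟩)
  have heps : ∀ t i, (fun ω => ε t ω i) ∈ 𝒢 := fun t i =>
    Submodule.subset_span (Set.mem_insert_of_mem _ ⟨Sum.inr (Sum.inl (t, i)), rfl⟩)
  have heta : ∀ t k, (fun ω => η t ω k) ∈ 𝒢 := fun t k =>
    Submodule.subset_span (Set.mem_insert_of_mem _ ⟨Sum.inr (Sum.inr (t, k)), rfl⟩)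
  have hx : ∀ t k, (fun ω => M.predError a0' P0' α0 ε η t ω k) ∈ 𝒢 := by
    intro t
    induction t with
    | zero => exact fun k => 𝒢.sub_mem (hinit k) (hconst (a0' k))
    | succ t ih =>
      intro k
      simp only [predError_succ]
      exact mulVec_add_mem _ ih (fun k => mulVec_add_mem _ (heps t) (heta t) k) k
  intro t i
  simp only [v'_eq]
  exact mulVec_add_mem _ (hx t) (heps t) i

end Probability
end Model

end SUTSE

end

theorem mainTheorem2 {d : ℕ} {p : Fin d → ℕ} (M : SUTSE.Model d p)
    {Ω : Type*} [MeasurableSpace Ω] (μ : Measure Ω) [IsProbabilityMeasure μ]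
    (α0 : Ω → SUTSE.StateIdx p → ℝ) (ε : ℕ → Ω → Fin d → ℝ)
    (η : ℕ → Ω → SUTSE.StateIdx p → ℝ) (hin : M.IsInput μ α0 ε η)
    (a0' : SUTSE.StateIdx p → ℝ) (P0' : ∀ j, Matrix (Fin (p j)) (Fin (p j)) ℝ)
    (hP0' : ∀ j, (P0' j).PosSemidef) (hM : M.Assumptions P0') :
    (∀ t i, MemLp (fun ω => M.v' a0' P0' α0 ε η t ω i) 2 μ) ∧
    ∃ V : Matrix (Fin d) (Fin d) ℝ,
      Tendsto (fun t => SUTSE.covMatrix μ (M.v' a0' P0' α0 ε η t)) atTop (𝓝 V) ∧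
      ∀ (n₀ : ℕ) (i j : Fin d),
        (∀ n, MemLp (fun ω => SUTSE.sampleCov (M.v' a0' P0' α0 ε η) n₀ n ω i j) 2 μ) ∧
        Tendsto (fun n => ∫ ω, SUTSE.sampleCov (M.v' a0' P0' α0 ε η) n₀ n ω i j ∂μ) atTop
          (𝓝 (V i j)) ∧
        (fun n : ℕ => Var[fun ω => SUTSE.sampleCov (M.v' a0' P0' α0 ε η) n₀ n ω i j; μ])
          =O[atTop] (fun n : ℕ => 1 / (n : ℝ)) ∧
        TendstoInMeasure μ
          (fun n ω => SUTSE.sampleCov (M.v' a0' P0' α0 ε η) n₀ n ω i j) atTop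
          (fun _ => V i j) := by
  obtain ⟨𝒢, h𝒢, hv⟩ := hin.exists_gaussian_submodule (a0' := a0') (P0' := P0')
  refine ⟨fun t i => (h𝒢 _ (hv t i)).memLp_two, ?_⟩
  obtain ⟨C, hC⟩ := hM.exists_norm_transition_le
  obtain ⟨P', hP', hlim, hpow⟩ := SUTSE.exists_kalman_limit hM.posDef' hM.controllable'
    (SUTSE.Model.posSemidef_blockDiagonal' hP0') hM.observable hC
  have hgain : Tendsto (fun t => M.T * M.gain' P0' t) atTop
      (𝓝 (M.T * SUTSE.kalmanK M.Z M.covEps' P')) :=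
    SUTSE.tendsto_matrix_mul tendsto_const_nhds (SUTSE.tendsto_kalmanK hM.posDef' hP' hlim)
  have hA : Tendsto (fun t => M.T * M.L' P0' t) atTop
      (𝓝 (M.T * SUTSE.kalmanL M.Z M.covEps' P')) :=
    SUTSE.tendsto_matrix_mul tendsto_const_nhds (SUTSE.tendsto_kalmanL hM.posDef' hP' hlim)
  have hgainT := ((continuous_id.matrix_transpose).tendsto _).comp hgain
  have hN := SUTSE.tendsto_matrix_mul hgain (tendsto_const_nhds (x := M.covEps))
  have hW := (SUTSE.tendsto_matrix_mul hN hgainT).add_const M.covEta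
  obtain ⟨V, D, ρ, hρ0, hρ1, hV, hcov, hmean⟩ :=
    (hin.isStateSpace (a0' := a0') (P0' := P0')).exists_stationary_limit hA hpow hW hN.neg M.Z
  simp only [← SUTSE.Model.v'_eq] at hV
  refine ⟨V, hV, fun n₀ i j => ?_⟩
  refine SUTSE.sampleCov_consistent (C := D) h𝒢 hv hρ0 hρ1 (fun t k i j => ?_) (fun i => ?_) hV n₀ i j
  · simpa only [SUTSE.Model.v'_eq] using hcov t k i j
  · simpa only [SUTSE.Model.v'_eq] using hmean i
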